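/- Let $(k,|\cdot|)$ be an algebraically closed field of characteristic $0$, complete with respect to an ultrametric (possibly trivial) absolute value. Let $\mathbb A^1_k$ be the Berkovich affine line with coordinate $T$, i.e. the set of multiplicative ultrametric seminorms on $k[T]$ extending $|\cdot|$. For $x\in\mathbb A^1_k$ let $\mathscr H(x)$ be its completed residue field, $T(x)\in\mathscr H(x)$ the value of the coordinate, and $r_k(x)=\inf_{c\in k}|T(x)-c|$. For a $k$-Banach algebra $E$ and $f\in E$, the Berkovich spectrum $\Sigma_{f,k}(E)$ is the set of $x\in\mathbb A^1_k$ such that $f\otimes 1-1\otimes T(x)$ is not invertible in the completed tensor product $E\hat\otimes_k\mathscr H(x)$. Let $\Omega$ be a field extension of $k$, complete with respect to an ultrametric absolute value extending that of $k$; this absolute value extends uniquely to an algebraic closure $\Omega^{alg}$. For $z\in\Omega^{alg}$ let $\pi(z)\in\mathbb A^1_k$ be the seminorm $f\mapsto|f(z)|$. Let $d:\Omega\to\Omega$ be a bounded $k$-derivation with operator norm $\|d\|$, and let $\mathscr D_\Omega=\bigoplus_{i\ge 0}\Omega\, d^i$ be the ring of differential polynomials, with $d\cdot f=d(f)+f\cdot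 d$ for $f\in\Omega$. Let $P(T)=T^n+\sum_{i<n}a_iT^i\in\Omega[T]$ be monic, put $P(d)=d^n+\sum_{i<n}a_id^i\in\mathscr D_\Omega$, and let $(M,\nabla)$ be a differential module over $(\Omega,d)$ isomorphic to $\mathscr D_\Omega/\mathscr D_\Omega\cdot P(d)$ with the connection given by left multiplication by $d$. Endow $M$ with any ultrametric norm making it an $\Omega$-Banach space, and let $\mathcal L_k(M)$ be the $k$-algebra of bounded $k$-linear endomorphisms of $M$ with the operator norm. Let $\{z_1,\dots,z_n\}\subset\Omega^{alg}$ be the multiset of roots of the commutative polynomial $P(T)$. **Theorem (spectral version of Young's theorem, strong version).** If $r_k(\pi(z_i))>\|d\|$ for every $i$, then $\nabla\in\mathcal L_k(M)$ and $$\Sigma_{\nabla,k}(\mathcal L_k(M))=\{\pi(z_1),\dots,\pi(z_n)\}.$$ -/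

import Mathlib

open Polynomial
open scoped NNReal TensorProduct

noncomputable section

namespace BerkovichSpectrum

/-! ### Bounded operators -/

section Operators

/-- A map between normed groups is bounded if `‖φ m‖ ≤ C ‖m‖` for some constant `C`.
(Over a trivially valued field this is stronger than continuity.) -/
def IsBoundedOp {M N : Type*} [Norm M] [Norm N] (φ : M → N) : Prop :=
  ∃ C : ℝ, ∀ m, ‖φ m‖ ≤ C * ‖m‖

/-- The operator norm: the infimum of all `C ≥ 0` with `‖φ m‖ ≤ C ‖m‖` for all `m`. -/
def opNorm {M N : Type*} [Norm M] [Norm N] (φ : M → N) : ℝ :=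
  sInf {C : ℝ | 0 ≤ C ∧ ∀ m, ‖φ m‖ ≤ C * ‖m‖}

variable {M N : Type*} [NormedAddCommGroup M] [NormedAddCommGroup N]

theorem opNorm_bddBelow (φ : M → N) :
    BddBelow {C : ℝ | 0 ≤ C ∧ ∀ m, ‖φ m‖ ≤ C * ‖m‖} := ⟨0, fun _ h => h.1⟩

theorem IsBoundedOp.nonempty {φ : M → N} (h : IsBoundedOp φ) :
    {C : ℝ | 0 ≤ C ∧ ∀ m, ‖φ m‖ ≤ C * ‖m‖}.Nonempty := by
  obtain ⟨C, hC⟩ := h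
  exact ⟨max C 0, le_max_right _ _, fun m => (hC m).trans
    (mul_le_mul_of_nonneg_right (le_max_left _ _) (norm_nonneg _))⟩

theorem opNorm_nonneg (φ : M → N) : 0 ≤ opNorm φ := Real.sInf_nonneg fun _ h => h.1

theorem opNorm_le {φ : M → N} {C : ℝ} (h0 : 0 ≤ C) (h : ∀ m, ‖φ m‖ ≤ C * ‖m‖) :
    opNorm φ ≤ C := csInf_le (opNorm_bddBelow φ) ⟨h0, h⟩

theorem IsBoundedOp.le_opNorm {φ : M → N} (h : IsBoundedOp φ) (m : M) :
    ‖φ m‖ ≤ opNorm φ * ‖m‖ := by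
  rcases (norm_nonneg m).eq_or_lt with hm | hm
  · obtain ⟨C, hC⟩ := h
    simpa [← hm] using hC m
  · rw [← div_le_iff₀ hm]
    exact le_csInf h.nonempty fun C hC => (div_le_iff₀ hm).2 (hC.2 m)

end Operators

section BoundedEnd

variable (k : Type*) [NormedField k] (M : Type*) [NormedAddCommGroup M] [NormedSpace k M]

/-- The algebra `L_k(M)` of bounded `k`-linear endomorphisms of `M`. -/
def BoundedEnd : Subalgebra k (Module.End k M) where
  carrier := {φ | IsBoundedOp φ}
  mul_mem' := by
    intro φ ψ hφ hψ
    refine ⟨opNorm φ * opNorm ψ, fun m => (hφ.le_opNorm (ψ m)).trans ?_⟩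
    rw [mul_assoc]
    exact mul_le_mul_of_nonneg_left (hψ.le_opNorm m) (opNorm_nonneg _)
  add_mem' := by
    intro φ ψ hφ hψ
    refine ⟨opNorm φ + opNorm ψ, fun m => (norm_add_le _ _).trans ?_⟩
    rw [add_mul]
    exact add_le_add (hφ.le_opNorm m) (hψ.le_opNorm m)
  algebraMap_mem' := fun a => ⟨‖a‖, fun m => by
    simpa [Module.algebraMap_end_apply] using norm_smul_le a m⟩

/-- `L_k(M)` with the operator norm. -/
instance : NormedRing (BoundedEnd k M) where
  norm φ := opNorm φ.1
  dist φ ψ := opNorm (-φ + ψ).1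
  dist_self φ := by
    refine le_antisymm (opNorm_le le_rfl fun m => ?_) (opNorm_nonneg _)
    simp
  dist_comm φ ψ := by
    have h (m : M) : ‖(-φ + ψ).1 m‖ = ‖(-ψ + φ).1 m‖ := by
      have : (-φ + ψ).1 m = -(-ψ + φ).1 m := by simp [add_comm]
      rw [this, norm_neg]
    simp only [opNorm, h]
  dist_triangle φ ψ χ := by
    refine opNorm_le (add_nonneg (opNorm_nonneg _) (opNorm_nonneg _)) fun m => ?_
    have : (-φ + χ).1 m = (-φ + ψ).1 m + (-ψ + χ).1 m := by simp
    rw [this, add_mul]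
    exact (norm_add_le _ _).trans
      (add_le_add (IsBoundedOp.le_opNorm (-φ + ψ).2 m) (IsBoundedOp.le_opNorm (-ψ + χ).2 m))
  eq_of_dist_eq_zero := by
    intro φ ψ h
    ext m
    have := IsBoundedOp.le_opNorm (-φ + ψ).2 m
    have h' : opNorm (-φ + ψ).1 = 0 := h
    rw [h', zero_mul] at this
    have h2 : (-φ + ψ).1 m = 0 := norm_le_zero_iff.1 this
    have h3 : -(φ.1 m) + ψ.1 m = 0 := h2
    exact (neg_add_eq_zero.1 h3)
  dist_eq _ _ := rfl
  norm_mul_le φ ψ := by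
    refine opNorm_le (mul_nonneg (opNorm_nonneg _) (opNorm_nonneg _)) fun m => ?_
    refine (IsBoundedOp.le_opNorm φ.2 (ψ.1 m)).trans ?_
    rw [mul_assoc]
    exact mul_le_mul_of_nonneg_left (IsBoundedOp.le_opNorm ψ.2 m) (opNorm_nonneg _)

instance : NormedAlgebra k (BoundedEnd k M) where
  norm_smul_le a φ := by
    refine opNorm_le (mul_nonneg (norm_nonneg _) (opNorm_nonneg _)) fun m => ?_
    have : (a • φ).1 m = a • φ.1 m := rfl
    rw [this, mul_assoc]
    exact (norm_smul_le _ _).trans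
      (mul_le_mul_of_nonneg_left (IsBoundedOp.le_opNorm φ.2 m) (norm_nonneg _))

end BoundedEnd

/-! ### The completed tensor product of two `k`-Banach algebras -/

section Tensor

variable (k : Type*) [NormedField k] (E H : Type*) [NormedRing E] [NormedAlgebra k E]
  [NormedRing H] [NormedAlgebra k H]

/-- The algebraic tensor product `E ⊗_k H`, to be equipped with the tensor product seminorm. -/
def TensorAlg : Type _ := E ⊗[k] H

instance : Ring (TensorAlg k E H) := inferInstanceAs (Ring (E ⊗[k] H))

variable {k E H}

/-- The pure tensor `e ⊗ h`. -/
def TensorAlg.tmul (e : E) (h : H) : TensorAlg k E H := e ⊗ₜ[k] h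

/-- `t.IsReprBy C` says that `t` is a finite sum `∑ eᵢ ⊗ hᵢ` with `max ‖eᵢ‖ ‖hᵢ‖ ≤ C`. -/
def TensorAlg.IsReprBy (t : TensorAlg k E H) (C : ℝ) : Prop :=
  t ∈ AddSubmonoid.closure
    {s : TensorAlg k E H | ∃ (e : E) (h : H), ‖e‖ * ‖h‖ ≤ C ∧ s = TensorAlg.tmul e h}

/-- The (non-archimedean) tensor product seminorm on `E ⊗_k H`: the infimum of
`maxᵢ ‖eᵢ‖ ‖hᵢ‖` over all representations `t = ∑ eᵢ ⊗ hᵢ`. -/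
def TensorAlg.seminorm (t : TensorAlg k E H) : ℝ := sInf {C : ℝ | 0 ≤ C ∧ t.IsReprBy C}

namespace TensorAlg

theorem IsReprBy.mono {t : TensorAlg k E H} {C D : ℝ} (h : t.IsReprBy C) (hCD : C ≤ D) :
    t.IsReprBy D :=
  AddSubmonoid.closure_mono
    (by rintro _ ⟨e, f, h1, h2⟩; exact ⟨e, f, h1.trans hCD, h2⟩) h

theorem IsReprBy.add {s t : TensorAlg k E H} {C : ℝ} (hs : s.IsReprBy C) (ht : t.IsReprBy C) :
    (s + t).IsReprBy C := AddSubmonoid.add_mem _ hs ht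

theorem IsReprBy.neg {t : TensorAlg k E H} {C : ℝ} (ht : t.IsReprBy C) : (-t).IsReprBy C := by
  unfold IsReprBy at ht
  induction ht using AddSubmonoid.closure_induction with
  | mem s hs =>
    obtain ⟨e, f, h1, rfl⟩ := hs
    exact AddSubmonoid.subset_closure
      (show ∃ (e' : E) (h : H), ‖e'‖ * ‖h‖ ≤ C ∧ -tmul e f = (tmul e' h : TensorAlg k E H) from
        ⟨-e, f, by rwa [norm_neg], (TensorProduct.neg_tmul e f).symm⟩)
  | zero => rw [neg_zero]; exact AddSubmonoid.zero_mem _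
  | add x y _ _ hx hy => rw [neg_add]; exact hx.add hy

theorem IsReprBy.mul {s t : TensorAlg k E H} {C D : ℝ} (hC : 0 ≤ C)
    (hs : s.IsReprBy C) (ht : t.IsReprBy D) : (s * t).IsReprBy (C * D) := by
  unfold IsReprBy at hs
  induction hs using AddSubmonoid.closure_induction with
  | zero => rw [zero_mul]; exact AddSubmonoid.zero_mem _
  | add x y _ _ hx hy => rw [add_mul]; exact hx.add hy
  | mem s hs =>
    obtain ⟨e, f, h1, rfl⟩ := hs
    unfold IsReprBy at ht
    induction ht using AddSubmonoid.closure_induction with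
    | zero => rw [mul_zero]; exact AddSubmonoid.zero_mem _
    | add x y _ _ hx hy => rw [mul_add]; exact hx.add hy
    | mem t ht =>
      obtain ⟨e', f', h2, rfl⟩ := ht
      refine AddSubmonoid.subset_closure ⟨e * e', f * f', ?_,
        Algebra.TensorProduct.tmul_mul_tmul (R := k) e e' f f'⟩
      calc ‖e * e'‖ * ‖f * f'‖ ≤ (‖e‖ * ‖e'‖) * (‖f‖ * ‖f'‖) := by
            gcongr
            · exact norm_mul_le _ _
            · exact norm_mul_le _ _
        _ = (‖e‖ * ‖f‖) * (‖e'‖ * ‖f'‖) := by ring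
        _ ≤ C * D := by gcongr

theorem exists_isReprBy (t : TensorAlg k E H) : {C : ℝ | 0 ≤ C ∧ t.IsReprBy C}.Nonempty := by
  refine TensorProduct.induction_on
    (motive := fun t : E ⊗[k] H => {C : ℝ | 0 ≤ C ∧ IsReprBy (k := k) t C}.Nonempty) t ?_ ?_ ?_
  · exact ⟨0, le_rfl, AddSubmonoid.zero_mem _⟩
  · intro e f
    exact ⟨‖e‖ * ‖f‖, by positivity, AddSubmonoid.subset_closure ⟨e, f, le_rfl, rfl⟩⟩
  · rintro x y ⟨C, hC, hx⟩ ⟨D, hD, hy⟩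
    exact ⟨max C D, hC.trans (le_max_left _ _),
      IsReprBy.add (k := k) (hx.mono (le_max_left _ _)) (hy.mono (le_max_right _ _))⟩

theorem seminorm_nonneg (t : TensorAlg k E H) : 0 ≤ t.seminorm := Real.sInf_nonneg fun _ h => h.1

theorem seminorm_le {t : TensorAlg k E H} {C : ℝ} (hC : 0 ≤ C) (h : t.IsReprBy C) :
    t.seminorm ≤ C := csInf_le ⟨0, fun _ h => h.1⟩ ⟨hC, h⟩

theorem isReprBy_of_lt {t : TensorAlg k E H} {C : ℝ} (h : t.seminorm < C) : t.IsReprBy C := by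
  obtain ⟨D, hD, hDC⟩ := exists_lt_of_csInf_lt (exists_isReprBy t) h
  exact hD.2.mono hDC.le

theorem seminorm_add_le_max (s t : TensorAlg k E H) :
    (s + t).seminorm ≤ max s.seminorm t.seminorm := by
  refine le_of_forall_pos_le_add fun ε hε => seminorm_le ?_ ?_
  · have := (seminorm_nonneg s).trans (le_max_left s.seminorm t.seminorm)
    linarith
  · refine (isReprBy_of_lt ?_).add (isReprBy_of_lt ?_)
    · linarith [le_max_left s.seminorm t.seminorm]
    · linarith [le_max_right s.seminorm t.seminorm]

theorem seminorm_neg (t : TensorAlg k E H) : (-t).seminorm = t.seminorm := by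
  have (t : TensorAlg k E H) : (-t).seminorm ≤ t.seminorm :=
    le_csInf (exists_isReprBy t) fun C hC => seminorm_le hC.1 hC.2.neg
  exact le_antisymm (this t) (by simpa using this (-t))

theorem seminorm_zero : (0 : TensorAlg k E H).seminorm = 0 :=
  le_antisymm (seminorm_le le_rfl (AddSubmonoid.zero_mem _)) (seminorm_nonneg _)

theorem seminorm_mul_le (s t : TensorAlg k E H) :
    (s * t).seminorm ≤ s.seminorm * t.seminorm := by
  have key : ∀ ε > 0, (s * t).seminorm ≤ (s.seminorm + ε) * (t.seminorm + ε) := fun ε hε => by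
    have h1 : 0 ≤ s.seminorm + ε := by linarith [seminorm_nonneg s]
    have h2 : 0 ≤ t.seminorm + ε := by linarith [seminorm_nonneg t]
    exact seminorm_le (mul_nonneg h1 h2)
      ((isReprBy_of_lt (by linarith)).mul h1 (isReprBy_of_lt (by linarith)))
  have hlim : Filter.Tendsto (fun ε : ℝ => (s.seminorm + ε) * (t.seminorm + ε))
      (nhdsWithin 0 (Set.Ioi 0)) (nhds (s.seminorm * t.seminorm)) := by
    have : Continuous fun ε : ℝ => (s.seminorm + ε) * (t.seminorm + ε) := by fun_prop
    simpa using (this.tendsto 0).mono_left nhdsWithin_le_nhds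
  exact ge_of_tendsto hlim (Filter.eventually_of_mem self_mem_nhdsWithin key)

end TensorAlg

instance : SeminormedRing (TensorAlg k E H) where
  norm t := t.seminorm
  dist s t := (-s + t).seminorm
  dist_self s := by simp [TensorAlg.seminorm_zero]
  dist_comm s t := by
    rw [← TensorAlg.seminorm_neg]
    simp [add_comm]
  dist_triangle r s t := by
    have : -r + t = (-r + s) + (-s + t) := by abel
    rw [this]
    exact (TensorAlg.seminorm_add_le_max _ _).trans
      (max_le_add_of_nonneg (TensorAlg.seminorm_nonneg _) (TensorAlg.seminorm_nonneg _))
  dist_eq _ _ := rfl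
  norm_mul_le := TensorAlg.seminorm_mul_le

variable (k E H)

/-- The completed tensor product `E ⊗̂_k H`. -/
abbrev CompletedTensor : Type _ := UniformSpace.Completion (TensorAlg k E H)

end Tensor

/-! ### The Berkovich affine line -/

section Line

/-- The Berkovich affine line `𝔸¹` over the ultrametric field `k`, with coordinate `T = X`:
its points are the multiplicative (non-archimedean) seminorms on `k[T]` that extend the
absolute value of `k`. -/
structure BerkovichLine (k : Type*) [NormedField k] where
  /-- the multiplicative seminorm `f ↦ |f(x)|` -/
  seminorm : Valuation k[X] ℝ≥0
  seminorm_C : ∀ a : k, seminorm (C a) = ‖a‖₊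

variable {k : Type*} [NormedField k]

/-- The radius `r_k(x) = inf_{c ∈ k} |T(x) - c|` of a point, for algebraically closed `k`. -/
def BerkovichLine.radius (x : BerkovichLine k) : ℝ := ⨅ c : k, (x.seminorm (X - C c) : ℝ)

/-- The fraction field of `k[T] / {f | |f(x)| = 0}`. -/
def BerkovichLine.PreResidueField (x : BerkovichLine k) : Type _ :=
  FractionRing (k[X] ⧸ x.seminorm.supp)

namespace BerkovichLine

variable (x : BerkovichLine k)

instance : Field x.PreResidueField := inferInstanceAs (Field (FractionRing (k[X] ⧸ x.seminorm.supp)))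

instance : Algebra (k[X] ⧸ x.seminorm.supp) x.PreResidueField :=
  inferInstanceAs (Algebra (k[X] ⧸ x.seminorm.supp) (FractionRing (k[X] ⧸ x.seminorm.supp)))

instance : IsFractionRing (k[X] ⧸ x.seminorm.supp) x.PreResidueField :=
  inferInstanceAs (IsFractionRing (k[X] ⧸ x.seminorm.supp) (FractionRing (k[X] ⧸ x.seminorm.supp)))

instance : Algebra k x.PreResidueField :=
  ((algebraMap (k[X] ⧸ x.seminorm.supp) x.PreResidueField).comp
    ((Ideal.Quotient.mk x.seminorm.supp).comp C)).toAlgebra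

/-- The value `f(x)` of a polynomial `f` at `x`, in the fraction field of `k[T] / x.supp`. -/
def preEval : k[X] →+* x.PreResidueField :=
  (algebraMap (k[X] ⧸ x.seminorm.supp) x.PreResidueField).comp (Ideal.Quotient.mk x.seminorm.supp)

/-- The absolute value on the fraction field of `k[T] / x.supp` induced by `x`. -/
def preValuation : Valuation x.PreResidueField ℝ≥0 :=
  (x.seminorm.onQuot le_rfl).extendToLocalization (S := nonZeroDivisors (k[X] ⧸ x.seminorm.supp))
    (by
      intro s hs (h : s ∈ (x.seminorm.onQuot le_rfl).supp)
      have h0 : (x.seminorm.onQuot le_rfl).supp = 0 := Valuation.supp_quot_supp x.seminorm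
      rw [h0] at h
      exact nonZeroDivisors.ne_zero hs (by simpa using h))
    x.PreResidueField

theorem preValuation_preEval (f : k[X]) : x.preValuation (x.preEval f) = x.seminorm f := by
  unfold preValuation preEval
  exact Valuation.extendToLocalization_apply_map_apply _ _ _ _

instance : NormedField x.PreResidueField where
  norm a := (x.preValuation a : ℝ)
  dist a b := (x.preValuation (-a + b) : ℝ)
  dist_self a := by simp
  dist_comm a b := by
    rw [← Valuation.map_neg]
    simp [add_comm]
  dist_triangle a b c := by
    have : -a + c = (-a + b) + (-b + c) := by abel
    rw [this]
    exact_mod_cast (x.preValuation.map_add _ _).trans (max_le_add_of_nonneg zero_le zero_le)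
  eq_of_dist_eq_zero := by
    intro a b h
    have h' : x.preValuation (-a + b) = 0 := by exact_mod_cast h
    exact neg_add_eq_zero.1 ((Valuation.zero_iff _).1 h')
  dist_eq _ _ := rfl
  norm_mul a b := by simp

theorem norm_preEval (f : k[X]) : ‖x.preEval f‖ = x.seminorm f :=
  congrArg NNReal.toReal (x.preValuation_preEval f)

instance : NormedAlgebra k x.PreResidueField where
  norm_smul_le a b := by
    have h : ‖algebraMap k x.PreResidueField a‖ = ‖a‖ := by
      have h1 : algebraMap k x.PreResidueField a = x.preEval (C a) := rfl
      rw [h1, norm_preEval, x.seminorm_C a]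
      rfl
    rw [Algebra.smul_def, norm_mul, h]

/-- The completed residue field `ℋ(x)`. -/
abbrev ResidueField : Type _ := UniformSpace.Completion x.PreResidueField

/-- The value `T(x) ∈ ℋ(x)` of the coordinate function at `x`. -/
def coord : x.ResidueField := ((x.preEval X : x.PreResidueField) : x.ResidueField)

end BerkovichLine

/-- The spectrum, in the sense of Berkovich, of an element `f` of a `k`-Banach algebra `E`: the
set of points `x` of the affine line such that `f ⊗ 1 - 1 ⊗ T(x)` is not invertible in
`E ⊗̂_k ℋ(x)`. -/
def spectrum (k : Type*) [NormedField k] {E : Type*} [NormedRing E] [NormedAlgebra k E]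
    (f : E) : Set (BerkovichLine k) :=
  {x | ¬ IsUnit ((TensorAlg.tmul f 1 - TensorAlg.tmul 1 x.coord : TensorAlg k E x.ResidueField) :
    CompletedTensor k E x.ResidueField)}

end Line

/-! ### Algebraic points over an extension, and their projections to the affine line -/

section Projection

variable (Ω : Type*) [NormedField Ω] [IsUltrametricDist Ω] [CompleteSpace Ω]

theorem spectralNorm_mul_of_complete (x y : AlgebraicClosure Ω) :
    spectralNorm Ω (AlgebraicClosure Ω) (x * y) =
      spectralNorm Ω (AlgebraicClosure Ω) x * spectralNorm Ω (AlgebraicClosure Ω) y := by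
  by_cases h : ∃ a : Ω, a ≠ 0 ∧ ‖a‖ ≠ 1
  · let _ : NontriviallyNormedField Ω := NontriviallyNormedField.ofNormNeOne h
    exact _root_.spectralAlgNorm_mul (K := Ω) x y
  · push Not at h
    have hle : ∀ a : Ω, ‖a‖ ≤ 1 := fun a => by
      by_cases ha : a = 0
      · simp [ha]
      · exact (h a ha).le
    have key : ∀ z : AlgebraicClosure Ω, z ≠ 0 →
        spectralNorm Ω (AlgebraicClosure Ω) z = 1 := by
      have hup : ∀ z : AlgebraicClosure Ω, spectralNorm Ω (AlgebraicClosure Ω) z ≤ 1 := fun z =>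
        (spectralValue_le_one_iff (minpoly.monic (Algebra.IsIntegral.isIntegral z))).2
          fun n => hle _
      intro z hz
      refine le_antisymm (hup z) ?_
      have h1 := _root_.spectralNorm_mul (K := Ω) (Algebra.IsAlgebraic.isAlgebraic z)
        (Algebra.IsAlgebraic.isAlgebraic z⁻¹)
      rw [mul_inv_cancel₀ hz, spectralNorm_one] at h1
      have h2 : spectralNorm Ω (AlgebraicClosure Ω) z *
          spectralNorm Ω (AlgebraicClosure Ω) z⁻¹ ≤
          spectralNorm Ω (AlgebraicClosure Ω) z * 1 :=
        mul_le_mul_of_nonneg_left (hup _) (spectralNorm_nonneg _)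
      linarith
    by_cases hx : x = 0
    · simp [hx, spectralNorm_zero]
    by_cases hy : y = 0
    · simp [hy, spectralNorm_zero]
    rw [key x hx, key y hy, key _ (mul_ne_zero hx hy), one_mul]

/-- The unique extension of the absolute value of the complete ultrametric field `Ω` to its
algebraic closure. -/
def algClosureValuation : Valuation (AlgebraicClosure Ω) ℝ≥0 where
  toFun z := ⟨spectralNorm Ω (AlgebraicClosure Ω) z, spectralNorm_nonneg z⟩
  map_zero' := NNReal.eq spectralNorm_zero
  map_one' := NNReal.eq spectralNorm_one
  map_mul' x y := NNReal.eq (spectralNorm_mul_of_complete Ω x y)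
  map_add_le_max' x y := by
    have := isNonarchimedean_spectralNorm (K := Ω) (L := AlgebraicClosure Ω) x y
    exact_mod_cast this

variable {Ω} (k : Type*) [NormedField k] [NormedAlgebra k Ω]

/-- The projection to the affine line over `k` of the point `z ∈ Ω^alg` of the affine line over
the completion of `Ω^alg`: the seminorm `f ↦ |f(z)|` on `k[T]`. -/
def projPoint (z : AlgebraicClosure Ω) : BerkovichLine k :=
  ⟨(algClosureValuation Ω).comap (aeval z : k[X] →ₐ[k] AlgebraicClosure Ω).toRingHom, fun a => by
    have h : (aeval z : k[X] →ₐ[k] AlgebraicClosure Ω) (C a) =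
        algebraMap Ω (AlgebraicClosure Ω) (algebraMap k Ω a) := by
      rw [aeval_C, ← IsScalarTower.algebraMap_apply]
    refine NNReal.eq ?_
    change spectralNorm Ω (AlgebraicClosure Ω)
      ((aeval z : k[X] →ₐ[k] AlgebraicClosure Ω) (C a)) = ‖a‖
    rw [h, spectralNorm_extends, norm_algebraMap']⟩

end Projection

/-! ### Differential polynomials and differential modules -/

section Differential

variable {k Ω : Type*} [Field k] [Field Ω] [Algebra k Ω] (d : Derivation k Ω Ω)

/-- The ring `𝒟 = ⨁ Ω dⁱ` of differential polynomials. The underlying additive group is that of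
`Ω[X]`, where `∑ aᵢ Xⁱ` stands for `∑ aᵢ dⁱ`; the multiplication is determined by
`d · f = d(f) + f · d` for `f ∈ Ω`. -/
def DiffPoly (_d : Derivation k Ω Ω) : Type _ := Polynomial Ω

namespace DiffPoly

instance : AddCommGroup (DiffPoly d) := inferInstanceAs (AddCommGroup (Polynomial Ω))

instance : Module Ω (DiffPoly d) := inferInstanceAs (Module Ω (Polynomial Ω))

instance : Module k (DiffPoly d) := inferInstanceAs (Module k (Polynomial Ω))

instance : IsScalarTower k Ω (DiffPoly d) := inferInstanceAs (IsScalarTower k Ω (Polynomial Ω))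

/-- The differential polynomial `P(d) = ∑ aᵢ dⁱ` attached to `P(T) = ∑ aᵢ Tⁱ`. -/
def ofPoly : (Polynomial Ω) ≃ₗ[Ω] DiffPoly d := LinearEquiv.refl Ω (Polynomial Ω)

/-- Left multiplication by `d`: it sends `g dʲ` to `d(g) dʲ + g dʲ⁺¹`. -/
def delta : (Polynomial Ω) →ₗ[k] (Polynomial Ω) :=
  lsum fun j => (monomial j).restrictScalars k ∘ₗ d.toLinearMap +
    (monomial (j + 1)).restrictScalars k

theorem delta_monomial (j : ℕ) (g : Ω) :
    delta d (monomial j g) = monomial j (d g) + monomial (j + 1) g := by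
  simp [delta, lsum_apply, sum_monomial_index]

theorem delta_smul (f : Ω) (Q : Polynomial Ω) : delta d (f • Q) = d f • Q + f • delta d Q := by
  induction Q using Polynomial.induction_on' with
  | add p q hp hq => simp only [smul_add, map_add, hp, hq]; abel
  | monomial j g =>
    simp only [smul_monomial, delta_monomial, smul_add, smul_eq_mul, Derivation.leibniz, map_add,
      mul_comm g]
    abel

/-- Left multiplication by `P(d) = ∑ aᵢ dⁱ`, that is `∑ aᵢ δⁱ`, where `δ` is left multiplication
by `d`. -/
def leftMul : (Polynomial Ω) →ₗ[k] Module.End k (Polynomial Ω) :=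
  lsum fun i =>
    { toFun := fun f => f • delta d ^ i
      map_add' := fun f g => add_smul f g _
      map_smul' := fun a f => smul_assoc a f _ }

theorem leftMul_monomial (i : ℕ) (f : Ω) : leftMul d (monomial i f) = f • delta d ^ i := by
  simp [leftMul, lsum_apply, sum_monomial_index]

theorem leftMul_smul (f : Ω) (P : Polynomial Ω) : leftMul d (f • P) = f • leftMul d P := by
  induction P using Polynomial.induction_on' with
  | add p q hp hq => simp only [smul_add, map_add, hp, hq]
  | monomial j g => simp only [smul_monomial, leftMul_monomial, smul_eq_mul, mul_smul]

theorem leftMul_delta (Q : Polynomial Ω) : leftMul d (delta d Q) = delta d * leftMul d Q := by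
  induction Q using Polynomial.induction_on' with
  | add p q hp hq => simp only [map_add, hp, hq, mul_add]
  | monomial j g =>
    ext1 R
    simp only [delta_monomial, map_add, leftMul_monomial, Module.End.mul_apply,
      LinearMap.add_apply, LinearMap.smul_apply, delta_smul, pow_succ']

theorem leftMul_leftMul (P Q : Polynomial Ω) :
    leftMul d (leftMul d P Q) = leftMul d P * leftMul d Q := by
  induction P using Polynomial.induction_on' with
  | add p q hp hq => simp only [map_add, LinearMap.add_apply, hp, hq, add_mul]
  | monomial i f =>
    have h : ∀ i : ℕ, leftMul d ((delta d ^ i) Q) = delta d ^ i * leftMul d Q := by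
      intro i
      induction i with
      | zero => simp
      | succ i ih => rw [pow_succ', Module.End.mul_apply, leftMul_delta, ih, mul_assoc]
    rw [leftMul_monomial, LinearMap.smul_apply, leftMul_smul, h, smul_mul_assoc]

theorem leftMul_one : leftMul d 1 = 1 := by
  have := leftMul_monomial d 0 (1 : Ω)
  simpa using this

theorem leftMul_apply_one (P : Polynomial Ω) : leftMul d P 1 = P := by
  have h : ∀ i : ℕ, (delta d ^ i) (1 : Polynomial Ω) = monomial i 1 := by
    intro i
    induction i with
    | zero => simp
    | succ i ih =>
      rw [pow_succ', Module.End.mul_apply, ih, delta_monomial]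
      simp
  induction P using Polynomial.induction_on' with
  | add p q hp hq => simp only [map_add, LinearMap.add_apply, hp, hq]
  | monomial i f => rw [leftMul_monomial, LinearMap.smul_apply, h, smul_monomial, smul_eq_mul,
      mul_one]

instance : Ring (DiffPoly d) where
  __ := (inferInstance : AddCommGroup (DiffPoly d))
  mul P Q := leftMul d P Q
  one := (1 : Polynomial Ω)
  left_distrib P Q R := (leftMul d P).map_add Q R
  right_distrib P Q R := LinearMap.congr_fun ((leftMul d).map_add P Q) R
  zero_mul P := LinearMap.congr_fun (leftMul d).map_zero P
  mul_zero P := (leftMul d P).map_zero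
  mul_assoc P Q R := LinearMap.congr_fun (leftMul_leftMul d P Q) R
  one_mul P := LinearMap.congr_fun (leftMul_one d) P
  mul_one P := leftMul_apply_one d P

instance : IsScalarTower Ω (DiffPoly d) (DiffPoly d) where
  smul_assoc f P Q := LinearMap.congr_fun (leftMul_smul d f P) Q

instance : IsScalarTower k (DiffPoly d) (DiffPoly d) where
  smul_assoc a P Q := LinearMap.congr_fun ((leftMul d).map_smul a P) Q

/-- The element `d` of the ring of differential polynomials. -/
def var : DiffPoly d := ofPoly d X

theorem var_mul (Q : Polynomial Ω) : var d * ofPoly d Q = ofPoly d (delta d Q) := by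
  change leftMul d (X : Polynomial Ω) Q = delta d Q
  rw [← monomial_one_one_eq_X, leftMul_monomial, pow_one, one_smul]

/-- The commutation rule `d · f = d(f) + f · d`. -/
theorem var_mul_C (f : Ω) :
    var d * ofPoly d (C f) = ofPoly d (C (d f)) + ofPoly d (C f) * var d := by
  have h : ofPoly d (C f) * var d = ofPoly d (monomial 1 f) := by
    change leftMul d (monomial 0 f) X = monomial 1 f
    rw [leftMul_monomial, LinearMap.smul_apply, pow_zero, Module.End.one_apply,
      ← monomial_one_one_eq_X, smul_monomial, smul_eq_mul, mul_one]
  rw [h, var_mul, ← monomial_zero_left, delta_monomial, map_add, monomial_zero_left]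

theorem var_pow (n : ℕ) : var d ^ n = ofPoly d (X ^ n) := by
  induction n with
  | zero => rfl
  | succ n ih =>
    rw [pow_succ', ih, var_mul, X_pow_eq_monomial, delta_monomial]
    simp [X_pow_eq_monomial]

theorem var_mul_smul (f : Ω) (Q : DiffPoly d) :
    var d * (f • Q) = d f • Q + f • (var d * Q) := by
  obtain ⟨Q, rfl⟩ := (ofPoly d).surjective Q
  rw [← map_smul, var_mul, delta_smul, map_add, map_smul, map_smul, var_mul]

end DiffPoly

/-- A connection on an `Ω`-vector space `M` over `(Ω, d)`: a `k`-linear map with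
`∇(f m) = d(f) m + f ∇(m)`. A differential module is a finite-dimensional `M` with a
connection. -/
structure Connection (M : Type*) [AddCommGroup M] [Module Ω M] [Module k M] where
  /-- the underlying `k`-linear map -/
  toLinearMap : M →ₗ[k] M
  leibniz : ∀ (f : Ω) (m : M), toLinearMap (f • m) = d f • m + f • toLinearMap m

/-- The left module `𝒟 / 𝒟 · P(d)`. -/
abbrev CyclicModule (P : Polynomial Ω) : Type _ :=
  DiffPoly d ⧸ (Ideal.span {DiffPoly.ofPoly d P} : Ideal (DiffPoly d))

/-- The connection on `𝒟 / 𝒟 · P(d)` given by left multiplication by `d`. -/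
def cyclicConnection (P : Polynomial Ω) : Connection d (CyclicModule d P) where
  toLinearMap :=
    { toFun := fun m => DiffPoly.var d • m
      map_add' := fun m n => smul_add _ m n
      map_smul' := by
        intro a m
        obtain ⟨Q, rfl⟩ := Submodule.Quotient.mk_surjective _ m
        have h : DiffPoly.var d * (a • Q) = a • (DiffPoly.var d * Q) := by
          obtain ⟨Q, rfl⟩ := (DiffPoly.ofPoly d).surjective Q
          exact (DiffPoly.leftMul d (X : Polynomial Ω)).map_smul a Q
        exact congrArg Submodule.Quotient.mk h }
  leibniz f m := by
    obtain ⟨Q, rfl⟩ := Submodule.Quotient.mk_surjective _ m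
    exact congrArg Submodule.Quotient.mk (DiffPoly.var_mul_smul d f Q)

variable {d}

/-- `(M, ∇) ≃ (N, ∇')` as differential modules over `(Ω, d)`. -/
def Connection.IsIsomorphic {M N : Type*} [AddCommGroup M] [Module Ω M] [Module k M]
    [AddCommGroup N] [Module Ω N] [Module k N] (D : Connection d M) (D' : Connection d N) : Prop :=
  ∃ e : M ≃ₗ[Ω] N, ∀ m, e (D.toLinearMap m) = D'.toLinearMap (e m)

end Differential

end BerkovichSpectrum

end

noncomputable section

namespace BerkovichSpectrum

/-! ### Noncommutative companion matrices -/

section Companion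

/-! Write t = T(x) and P = ∑ aᵢTⁱ. In the basis of M given by the classes of the dⁱ, the operator ∇
⊗ 1 - 1 ⊗ t becomes a companion matrix over the noncommutative algebra L_k(Ω) ⊗̂ ℋ(x), minus the
scalar t - d. Elimination reduces its invertibility to that of the single operator U = ∑ (t - d)ⁱ
aᵢ. Since t commutes with d and with Ω, a Taylor expansion gives U = ∑ (-d)ʲ P^[j](t), where P^[j]
is the j-th divided derivative. The term j = 0 is multiplication by P(t), and the hypothesis on the
radii makes it dominate: all other terms are smaller by a factor at most ‖d‖/ρ < 1, for a suitable
ρ.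

If x is below no root, the domination is proved factor by factor. For a root z, choose c ∈ k with
|T(x) - c| ≠ |z - c|. Expanded around c, the minimal polynomial of z evaluated at t has a single
dominant term, either the constant one or the leading one. It is therefore invertible, and its
divided derivatives are controlled by g = max(|T(x) - c|, |z - c|) ≥ r_k(π(z))
(`dominatesDerivatives_minpoly`). The Leibniz rule extends this to P, so U = (1 + small) P(t) is a
unit (`DominatesDerivatives.isUnit_adjoint`), and hence so is ∇ ⊗ 1 - 1 ⊗ t (`isUnit_of_companion`,
`notMem_spectrum_of_companion`).

If x = π(z) with P(z) = 0, put r = r_k(x). The seminorm of Ω ⊗ ℋ(x) is the Gauss norm of the disc of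
centre z and radius r (`norm_tensorMap_gaussPoint`), hence multiplicative, and Cauchy's estimates
give ‖Uy - P(t)y‖ ≤ (‖d‖/r)‖P(t)y‖ for all y. The contraction from Ω ⊗ ℋ(x) to the residue field of
z kills P(t), so P(t)y never comes within distance < 1 of -1, and neither does Uy
(`one_le_norm_adjoint_add_one`). An inverse of ∇ ⊗ 1 - 1 ⊗ t would produce such a y
(`CompanionForms.projPoint_mem_spectrum`). -/

/-- The sum telescopes: δʲ y_{j-1} cancels against the δʲ y_{j-1} coming from index j - 1. A module
Y is allowed because the recurrence is used both inside a ring and for operators acting on Ω ⊗ ℋ(x).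
-/
theorem sum_pow_smul_of_recurrence {R Y : Type*} [Ring R] [AddCommGroup Y] [Module R Y]
    (δ : R) (y z w : ℕ → Y) (m : ℕ) (h0 : w 0 = -(δ • y 0) - z 0)
    (h : ∀ j, j + 1 ≤ m → w (j + 1) = y j - δ • y (j + 1) - z (j + 1)) :
    ∑ j ∈ Finset.range (m + 1), δ ^ j • w j =
      -(δ ^ (m + 1) • y m) - ∑ j ∈ Finset.range (m + 1), δ ^ j • z j := by
  induction m with
  | zero => simp [h0]
  | succ m ih =>
    rw [Finset.sum_range_succ, ih fun j hj => h j (by omega), h m le_rfl,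
      Finset.sum_range_succ (fun j => δ ^ j • z j) (m + 1), smul_sub, smul_sub, ← mul_smul, ← pow_succ]
    abel

/-- An operator `N` which is, in terms of "columns" `s` and "rows" `r`, the companion matrix of
`∑ Tⁱ aᵢ` minus the scalar `δ`, is invertible as soon as `∑ δⁱ aᵢ` is. -/
theorem isUnit_of_companion {B : Type*} [Ring B] (n : ℕ) (s r a : ℕ → B) (δ N : B)
    (hsum : ∑ i ∈ Finset.range n, s i * r i = 1)
    (hr0 : 0 < n → r 0 * N = -(δ * r 0) - a 0 * r (n - 1))
    (hr : ∀ j, j + 1 < n → r (j + 1) * N = r j - δ * r (j + 1) - a (j + 1) * r (n - 1))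
    (hs : ∀ i, i + 1 < n → N * s i = s (i + 1) - s i * δ)
    (hsn : 0 < n → N * s (n - 1) = -(s (n - 1) * δ) - ∑ i ∈ Finset.range n, s i * a i)
    (hu : IsUnit (δ ^ n + ∑ i ∈ Finset.range n, δ ^ i * a i)) : IsUnit N := by
  rcases n with _ | m
  · have : Subsingleton B := subsingleton_of_zero_eq_one (by simpa using hsum)
    exact isUnit_of_subsingleton _
  simp only [Nat.add_sub_cancel, Nat.zero_lt_succ, forall_const] at *
  obtain ⟨u, hu⟩ := hu
  -- Work in the left ideal generated by N. The telescoped recurrence puts u · r m in it, hence r m;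
  -- descending along the rows gives every r j, hence 1 = ∑ sᵢ rᵢ.
  have hleft : ∃ L, L * N = 1 := by
    let I : Ideal B := Ideal.span {N}
    have hN (b : B) : b * N ∈ I := I.mul_mem_left b (Ideal.subset_span rfl)
    have key := sum_pow_smul_of_recurrence δ r (fun j => a j * r m) (fun j => r j * N) m
      (by simpa using hr0) (fun j hj => by simpa using hr j (by omega))
    have hm : r m ∈ I := by
      have h1 : (u : B) * r m ∈ I := by
        rw [hu, add_mul, Finset.sum_mul]
        have h2 : δ ^ (m + 1) * r m + ∑ i ∈ Finset.range (m + 1), δ ^ i * a i * r m =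
            -∑ j ∈ Finset.range (m + 1), δ ^ j • (r j * N) := by
          rw [key]
          simp only [smul_eq_mul, mul_assoc]
          abel
        rw [h2]
        exact I.neg_mem (I.sum_mem fun j _ => I.smul_mem _ (hN _))
      simpa using I.mul_mem_left (↑u⁻¹ : B) h1
    have hall : ∀ i, i ≤ m → r (m - i) ∈ I := by
      intro i
      induction i with
      | zero => intro _; simpa using hm
      | succ i ih =>
        intro hi
        have h1 := hr (m - (i + 1)) (by omega)
        have h2 : m - (i + 1) + 1 = m - i := by omega
        rw [h2] at h1
        have h3 : r (m - (i + 1)) = r (m - i) * N + δ * r (m - i) + a (m - i) * r m := by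
          rw [h1]; abel
        rw [h3]
        exact I.add_mem (I.add_mem (hN _) (I.mul_mem_left _ (ih (by omega))))
          (I.mul_mem_left _ hm)
    have h1 : (1 : B) ∈ I := by
      rw [← hsum]
      refine I.sum_mem fun i hi => I.mul_mem_left _ ?_
      have := hall (m - i) (by omega)
      rwa [Nat.sub_sub_self (by have := Finset.mem_range.1 hi; omega)] at this
    exact Ideal.mem_span_singleton'.1 h1
  -- A left inverse does not suffice in a noncommutative ring. Modulo the right ideal N · B one has
  -- s i ≡ s 0 · δⁱ, and the relation for the last column becomes s 0 · u ≡ 0; hence all columns,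
  -- and then 1, lie in N · B.
  have hright : ∃ R, N * R = 1 := by
    have hpow : ∀ i, i ≤ m → ∃ b, s i = s 0 * δ ^ i + N * b := by
      intro i
      induction i with
      | zero => exact fun _ => ⟨0, by simp⟩
      | succ i ih =>
        intro hi
        obtain ⟨b, hb⟩ := ih (by omega)
        refine ⟨b * δ + s i, ?_⟩
        have := hs i (by omega)
        rw [mul_add, this, ← mul_assoc, pow_succ, ← mul_assoc]
        rw [hb, add_mul]
        abel
    choose! b hb using hpow
    have h0 : s 0 * u = N * (-s m - b m * δ - ∑ i ∈ Finset.range (m + 1), b i * a i) := by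
      rw [mul_sub, mul_sub, mul_neg, hsn, Finset.mul_sum, hu, mul_add, Finset.mul_sum]
      have h1 : ∑ i ∈ Finset.range (m + 1), s i * a i =
          ∑ i ∈ Finset.range (m + 1), s 0 * (δ ^ i * a i) +
            ∑ i ∈ Finset.range (m + 1), N * (b i * a i) := by
        rw [← Finset.sum_add_distrib]
        refine Finset.sum_congr rfl fun i hi => ?_
        rw [hb i (by have := Finset.mem_range.1 hi; omega), add_mul, mul_assoc, mul_assoc]
      rw [h1]
      rw [hb m le_rfl]
      rw [add_mul, pow_succ]
      simp only [mul_assoc]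
      abel
    have h0' : s 0 = N * ((-s m - b m * δ - ∑ i ∈ Finset.range (m + 1), b i * a i) *
        (↑u⁻¹ : B)) := by
      rw [← mul_assoc, ← h0, mul_assoc, Units.mul_inv, mul_one]
    generalize (-s m - b m * δ - ∑ i ∈ Finset.range (m + 1), b i * a i) * (↑u⁻¹ : B) = c at h0'
    refine ⟨∑ i ∈ Finset.range (m + 1), (c * δ ^ i + b i) * r i, ?_⟩
    rw [← hsum, Finset.mul_sum]
    refine Finset.sum_congr rfl fun i hi => ?_
    rw [hb i (by have := Finset.mem_range.1 hi; omega), ← mul_assoc, mul_add, ← mul_assoc, ← h0']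
  obtain ⟨L, hL⟩ := hleft
  obtain ⟨R, hR⟩ := hright
  exact ⟨⟨N, R, hR, by rw [← left_inv_eq_right_inv hL hR, hL]⟩, rfl⟩

/-- Taylor expansion of the formal adjoint of a differential polynomial. -/
theorem sum_sub_pow_mul_eq_sum_hasseDeriv {A R : Type*} [CommRing A] [Ring R] (θ : A[X] →+* R)
    (D : R) (hD : Commute D (θ X)) (P : A[X]) (n : ℕ) (hn : P.natDegree < n) :
    ∑ i ∈ Finset.range n, (θ X - D) ^ i * θ (C (P.coeff i)) =
      ∑ j ∈ Finset.range n, (-D) ^ j * θ (hasseDeriv j P) := by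
  have h1 (j : ℕ) : hasseDeriv j P = ∑ i ∈ Finset.range n,
      (i.choose j : A[X]) * X ^ (i - j) * C (P.coeff i) := by
    conv_lhs => rw [P.as_sum_range' n hn]
    rw [map_sum]
    refine Finset.sum_congr rfl fun i _ => ?_
    rw [hasseDeriv_monomial, ← C_mul_X_pow_eq_monomial, C_mul, map_natCast C]
    ring
  simp only [h1, map_sum, Finset.mul_sum]
  rw [Finset.sum_comm]
  refine Finset.sum_congr rfl fun i hi => ?_
  -- Only D and θ X need to commute: the coefficients stay on the right and are never moved past D.
  rw [sub_eq_neg_add, (hD.neg_left).add_pow', Finset.Nat.sum_antidiagonal_eq_sum_range_succ_mk,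
    Finset.sum_mul]
  rw [← Finset.sum_subset (Finset.range_mono (Finset.mem_range.1 hi) :
    Finset.range i.succ ⊆ Finset.range n)]
  · refine Finset.sum_congr rfl fun j _ => ?_
    simp only [map_mul, map_pow, map_natCast, nsmul_eq_mul]
    simp only [← mul_assoc]
    rw [(Nat.cast_commute (i.choose j) ((-D) ^ j)).eq]
  · intro j _ hj
    have : i < j := by simpa using hj
    rw [Nat.choose_eq_zero_of_lt this]
    simp

end Companion

/-! ### Maps out of (completed) tensor products -/

section TensorMaps

instance {A : Type*} [SeminormedAddCommGroup A] [IsUltrametricDist A] :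
    IsUltrametricDist (UniformSpace.Completion A) := by
  refine IsUltrametricDist.isUltrametricDist_of_forall_norm_add_le_max_norm fun x y => ?_
  induction x, y using UniformSpace.Completion.induction_on₂ with
  | hp => exact isClosed_le (by fun_prop) (by fun_prop)
  | ih a b =>
    rw [← UniformSpace.Completion.coe_add]
    simpa only [UniformSpace.Completion.norm_coe] using IsUltrametricDist.norm_add_le_max a b

/-- Geometric series. The inverse satisfies w⁻¹ = 1 - s w⁻¹, and ‖w⁻¹‖ > 1 would make both terms on
the right strictly smaller than w⁻¹, against the ultrametric inequality. -/
theorem exists_unit_of_norm_lt_one {A : Type*} [NormedRing A] [CompleteSpace A]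
    [IsUltrametricDist A] (h1 : ‖(1 : A)‖ ≤ 1) {s : A} (hs : ‖s‖ < 1) :
    ∃ w : Aˣ, (w : A) = 1 + s ∧ ‖(↑w⁻¹ : A)‖ ≤ 1 := by
  refine ⟨Units.oneSub (-s) (by rwa [norm_neg]), by simp, ?_⟩
  set w := Units.oneSub (-s) (by rwa [norm_neg]) with hw
  have h2 : (↑w⁻¹ : A) = 1 - s * ↑w⁻¹ := by
    have h3 : (w : A) * ↑w⁻¹ = 1 := Units.mul_inv w
    rw [hw, Units.val_oneSub, ← hw, sub_neg_eq_add, add_mul, one_mul] at h3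
    exact eq_sub_of_add_eq h3
  by_contra! h
  have h4 : ‖(↑w⁻¹ : A)‖ ≤ max ‖(1 : A)‖ ‖s * ↑w⁻¹‖ := by
    conv_lhs => rw [h2, sub_eq_add_neg]
    simpa only [norm_neg] using IsUltrametricDist.norm_add_le_max (1 : A) (-(s * ↑w⁻¹))
  have h5 : ‖s * ↑w⁻¹‖ < ‖(↑w⁻¹ : A)‖ :=
    (norm_mul_le _ _).trans_lt (by nlinarith)
  exact absurd (max_lt (h1.trans_lt h) h5) (not_lt.2 h4)

variable {k : Type*} [NormedField k] {E E' H : Type*} [NormedRing E] [NormedAlgebra k E]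
  [NormedRing E'] [NormedAlgebra k E'] [NormedRing H] [NormedAlgebra k H]

instance : IsUltrametricDist (TensorAlg k E H) :=
  IsUltrametricDist.isUltrametricDist_of_forall_norm_add_le_max_norm TensorAlg.seminorm_add_le_max

namespace TensorAlg

theorem norm_tmul_le (e : E) (h : H) : ‖(tmul e h : TensorAlg k E H)‖ ≤ ‖e‖ * ‖h‖ :=
  seminorm_le (by positivity) (AddSubmonoid.subset_closure ⟨e, h, le_rfl, rfl⟩)

theorem tmul_mul_tmul (e e' : E) (h h' : H) :
    (tmul e h * tmul e' h' : TensorAlg k E H) = tmul (e * e') (h * h') :=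
  Algebra.TensorProduct.tmul_mul_tmul (R := k) e e' h h'

theorem one_def : (1 : TensorAlg k E H) = tmul 1 1 := rfl

theorem add_tmul (e e' : E) (h : H) :
    (tmul (e + e') h : TensorAlg k E H) = tmul e h + tmul e' h := TensorProduct.add_tmul e e' h

theorem tmul_add (e : E) (h h' : H) :
    (tmul e (h + h') : TensorAlg k E H) = tmul e h + tmul e h' := TensorProduct.tmul_add e h h'

@[elab_as_elim]
theorem induction {p : TensorAlg k E H → Prop} (v : TensorAlg k E H) (h0 : p 0)
    (ht : ∀ e h, p (tmul e h)) (ha : ∀ v w, p v → p w → p (v + w)) : p v :=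
  TensorProduct.induction_on (motive := p) v h0 ht ha

theorem norm_one_le (hE : ‖(1 : E)‖ ≤ 1) (hH : ‖(1 : H)‖ ≤ 1) : ‖(1 : TensorAlg k E H)‖ ≤ 1 := by
  rw [one_def]
  exact (norm_tmul_le _ _).trans (mul_le_one₀ hE (norm_nonneg _) hH)

/-- Universal property of the tensor seminorm: for an ultrametric target, a bound on pure tensors
passes to sums without loss. -/
theorem norm_map_le {G : Type*} [SeminormedAddCommGroup G] [IsUltrametricDist G]
    (f : TensorAlg k E H →+ G) {C : ℝ} (hC : 0 ≤ C)
    (hf : ∀ e h, ‖f (tmul e h)‖ ≤ C * (‖e‖ * ‖h‖)) (v : TensorAlg k E H) : ‖f v‖ ≤ C * ‖v‖ := by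
  have key : ∀ D, ‖v‖ < D → ‖f v‖ ≤ C * D := fun D hD => by
    have hD0 : 0 ≤ C * D := mul_nonneg hC ((norm_nonneg v).trans hD.le)
    have h : v.IsReprBy D := isReprBy_of_lt hD
    unfold IsReprBy at h
    clear hD
    induction h using AddSubmonoid.closure_induction with
    | mem s hs =>
      obtain ⟨e, h, h1, rfl⟩ := hs
      exact (hf e h).trans (mul_le_mul_of_nonneg_left h1 hC)
    | zero => simpa using hD0
    | add x y _ _ hx hy =>
      rw [map_add]
      exact (IsUltrametricDist.norm_add_le_max _ _).trans (max_le hx hy)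
  have hlim : Filter.Tendsto (fun D : ℝ => C * D) (nhdsWithin ‖v‖ (Set.Ioi ‖v‖))
      (nhds (C * ‖v‖)) :=
    ((continuous_const_mul C).tendsto _).mono_left nhdsWithin_le_nhds
  exact ge_of_tendsto hlim (Filter.eventually_of_mem self_mem_nhdsWithin key)

/-- Base change of a `k`-linear map to `H`. -/
def map (φ : E →ₗ[k] E') : TensorAlg k E H →+ TensorAlg k E' H :=
  (TensorProduct.map φ (LinearMap.id : H →ₗ[k] H)).toAddMonoidHom

theorem map_tmul (φ : E →ₗ[k] E') (e : E) (h : H) :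
    map φ (tmul e h : TensorAlg k E H) = tmul (φ e) h := rfl

theorem norm_map_apply_le (φ : E →ₗ[k] E') {C : ℝ} (hC : 0 ≤ C) (hφ : ∀ e, ‖φ e‖ ≤ C * ‖e‖)
    (v : TensorAlg k E H) : ‖map φ v‖ ≤ C * ‖v‖ :=
  norm_map_le _ hC (fun e h => (norm_tmul_le _ _).trans
    ((mul_le_mul_of_nonneg_right (hφ e) (norm_nonneg h)).trans_eq (mul_assoc _ _ _))) v

/-- Base change of a homomorphism of `k`-algebras to `H`. -/
def mapRingHom (φ : E →ₐ[k] E') : TensorAlg k E H →+* TensorAlg k E' H :=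
  (Algebra.TensorProduct.map φ (AlgHom.id k H)).toRingHom

theorem mapRingHom_tmul (φ : E →ₐ[k] E') (e : E) (h : H) :
    mapRingHom φ (tmul e h : TensorAlg k E H) = tmul (φ e) h := rfl

theorem continuous_mapRingHom (φ : E →ₐ[k] E') {C : ℝ} (hC : 0 ≤ C)
    (hφ : ∀ e, ‖φ e‖ ≤ C * ‖e‖) :
    Continuous (mapRingHom φ : TensorAlg k E H →+* TensorAlg k E' H) :=
  AddMonoidHomClass.continuous_of_bound _ C
    (norm_map_apply_le (H := H) φ.toLinearMap hC hφ)

variable (E) in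
/-- The map `h ↦ 1 ⊗ h`. -/
def inr : H →+* TensorAlg k E H :=
  (Algebra.TensorProduct.includeRight : H →ₐ[k] E ⊗[k] H).toRingHom

variable (H) in
/-- The map `e ↦ e ⊗ 1`. -/
def inl : E →+* TensorAlg k E H :=
  (Algebra.TensorProduct.includeLeft : E →ₐ[k] E ⊗[k] H).toRingHom

theorem inr_apply (h : H) : inr E h = (tmul 1 h : TensorAlg k E H) := rfl

theorem inl_apply (e : E) : inl H e = (tmul e 1 : TensorAlg k E H) := rfl

end TensorAlg

end TensorMaps

/-! ### Evaluation at points of the affine line -/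

namespace BerkovichLine

section Eval

variable {k : Type*} [NormedField k] (x : BerkovichLine k)

theorem ext_seminorm {x y : BerkovichLine k} (h : ∀ f, x.seminorm f = y.seminorm f) : x = y := by
  obtain ⟨s, hs⟩ := x
  obtain ⟨t, ht⟩ := y
  obtain rfl : s = t := Valuation.ext h
  rfl

instance : IsUltrametricDist x.PreResidueField :=
  IsUltrametricDist.isUltrametricDist_of_forall_norm_add_le_max_norm fun a b => by
    exact_mod_cast x.preValuation.map_add a b

/-- The value of a polynomial at a point, in the completed residue field. -/
def evalHom : k[X] →+* x.ResidueField :=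
  UniformSpace.Completion.coeRingHom.comp x.preEval

theorem evalHom_apply (f : k[X]) :
    x.evalHom f = ((x.preEval f : x.PreResidueField) : x.ResidueField) := rfl

theorem evalHom_X : x.evalHom X = x.coord := rfl

theorem evalHom_C (a : k) : x.evalHom (C a) = algebraMap k x.ResidueField a := rfl

theorem norm_evalHom (f : k[X]) : ‖x.evalHom f‖ = x.seminorm f := by
  rw [evalHom_apply, UniformSpace.Completion.norm_coe, norm_preEval]

theorem exists_preEval_div (a : x.PreResidueField) :
    ∃ f q : k[X], x.preEval q ≠ 0 ∧ a = x.preEval f / x.preEval q := by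
  obtain ⟨f, q, hq, rfl⟩ := IsFractionRing.div_surjective (A := k[X] ⧸ x.seminorm.supp) a
  obtain ⟨f, rfl⟩ := Ideal.Quotient.mk_surjective f
  obtain ⟨q, rfl⟩ := Ideal.Quotient.mk_surjective q
  refine ⟨f, q, fun h => nonZeroDivisors.ne_zero hq ?_, rfl⟩
  exact (IsFractionRing.injective (k[X] ⧸ x.seminorm.supp) x.PreResidueField)
    (h.trans (map_zero _).symm)

theorem evalHom_ne_zero {q : k[X]} (hq : x.preEval q ≠ 0) : x.evalHom q ≠ 0 := by
  rw [← norm_ne_zero_iff, evalHom_apply, UniformSpace.Completion.norm_coe]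
  exact norm_ne_zero_iff.2 hq

theorem exists_norm_sub_evalHom_div_lt (h : x.ResidueField) {ε : ℝ} (hε : 0 < ε) :
    ∃ f q : k[X], x.evalHom q ≠ 0 ∧ ‖h - x.evalHom f * (x.evalHom q)⁻¹‖ < ε := by
  obtain ⟨a, ha⟩ := (UniformSpace.Completion.denseRange_coe
    (α := x.PreResidueField)).exists_dist_lt h hε
  obtain ⟨f, q, hq, rfl⟩ := x.exists_preEval_div a
  refine ⟨f, q, x.evalHom_ne_zero hq, ?_⟩
  rw [dist_eq_norm] at ha
  have h1 : x.evalHom f * (x.evalHom q)⁻¹ =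
      ((x.preEval f / x.preEval q : x.PreResidueField) : x.ResidueField) := by
    rw [div_eq_mul_inv, UniformSpace.Completion.coe_mul, evalHom_apply, evalHom_apply]
    congr 1
    refine inv_eq_of_mul_eq_one_right ?_
    rw [← UniformSpace.Completion.coe_mul, mul_inv_cancel₀ hq]
    rfl
  rw [h1]
  exact ha

end Eval

section LiesOver

variable {k : Type*} [NormedField k] {Ω : Type*} [NormedField Ω] [NormedAlgebra k Ω]

/-- The point `y` of the affine line over `Ω` is mapped to `x` by the projection to the affine
line over `k`. -/
def LiesOver (y : BerkovichLine Ω) (x : BerkovichLine k) : Prop :=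
  ∀ f : k[X], y.seminorm (f.map (algebraMap k Ω)) = x.seminorm f

variable {y : BerkovichLine Ω} {x : BerkovichLine k} (h : y.LiesOver x)

/-- The embedding of `Frac (k[T] / x.supp)` into `ℋ(y)` when `y` lies over `x`. -/
def LiesOver.preMap : x.PreResidueField →+* y.ResidueField :=
  IsFractionRing.lift (A := k[X] ⧸ x.seminorm.supp)
    (g := Ideal.Quotient.lift x.seminorm.supp (y.evalHom.comp (mapRingHom (algebraMap k Ω)))
      fun f hf => by
        rw [← norm_eq_zero, RingHom.comp_apply, norm_evalHom, coe_mapRingHom, h f,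
          (Valuation.mem_supp_iff _ _).1 hf, NNReal.coe_zero])
    (by
      refine (injective_iff_map_eq_zero _).2 fun f hf => ?_
      obtain ⟨f, rfl⟩ := Ideal.Quotient.mk_surjective f
      rw [Ideal.Quotient.lift_mk, ← norm_eq_zero, RingHom.comp_apply, norm_evalHom,
        coe_mapRingHom, h f, NNReal.coe_eq_zero] at hf
      exact Ideal.Quotient.eq_zero_iff_mem.2 ((Valuation.mem_supp_iff _ _).2 hf))

theorem LiesOver.preMap_preEval (f : k[X]) :
    h.preMap (x.preEval f) = y.evalHom (f.map (algebraMap k Ω)) :=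
  IsFractionRing.lift_algebraMap _ _

theorem LiesOver.norm_preMap (a : x.PreResidueField) : ‖h.preMap a‖ = ‖a‖ := by
  obtain ⟨f, q, hq, rfl⟩ := x.exists_preEval_div a
  rw [map_div₀, norm_div, norm_div, h.preMap_preEval, h.preMap_preEval, norm_evalHom, norm_evalHom,
    norm_preEval, norm_preEval, h f, h q]

theorem LiesOver.continuous_preMap : Continuous h.preMap :=
  AddMonoidHomClass.continuous_of_bound h.preMap 1 fun a => by rw [h.norm_preMap, one_mul]

/-- The embedding `ℋ(x) → ℋ(y)` when `y` lies over `x`. -/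
def LiesOver.residueMap : x.ResidueField →+* y.ResidueField :=
  UniformSpace.Completion.extensionHom h.preMap h.continuous_preMap

theorem LiesOver.residueMap_coe (a : x.PreResidueField) :
    h.residueMap (a : x.ResidueField) = h.preMap a :=
  UniformSpace.Completion.extensionHom_coe _ h.continuous_preMap a

theorem LiesOver.residueMap_evalHom (f : k[X]) :
    h.residueMap (x.evalHom f) = y.evalHom (f.map (algebraMap k Ω)) := by
  rw [evalHom_apply, h.residueMap_coe, h.preMap_preEval]

theorem LiesOver.norm_residueMap (a : x.ResidueField) : ‖h.residueMap a‖ = ‖a‖ := by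
  induction a using UniformSpace.Completion.induction_on with
  | hp =>
    exact isClosed_eq (UniformSpace.Completion.continuous_extension.norm) continuous_norm
  | ih a => rw [h.residueMap_coe, h.norm_preMap, UniformSpace.Completion.norm_coe]

/-- The homomorphism `Ω ⊗_k ℋ(x) → ℋ(y)` when `y` lies over `x`. -/
def LiesOver.tensorMap : TensorAlg k Ω x.ResidueField →+* y.ResidueField :=
  letI : Algebra k y.ResidueField :=
    ((algebraMap Ω y.ResidueField).comp (algebraMap k Ω)).toAlgebra
  (Algebra.TensorProduct.lift
    (⟨algebraMap Ω y.ResidueField, fun _ => rfl⟩ : Ω →ₐ[k] y.ResidueField)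
    (⟨h.residueMap, fun c => by
      change h.residueMap (x.evalHom (C c)) = _
      rw [h.residueMap_evalHom, map_C, evalHom_C]; rfl⟩ :
        x.ResidueField →ₐ[k] y.ResidueField)
    (fun _ _ => Commute.all _ _)).toRingHom

theorem LiesOver.tensorMap_tmul (a : Ω) (b : x.ResidueField) :
    h.tensorMap (TensorAlg.tmul a b) = algebraMap Ω y.ResidueField a * h.residueMap b :=
  rfl

/-- Both Ω and ℋ(x) embed isometrically in ℋ(y), so pure tensors do not grow. -/
theorem LiesOver.norm_tensorMap_le (v : TensorAlg k Ω x.ResidueField) :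
    ‖h.tensorMap v‖ ≤ ‖v‖ := by
  have := TensorAlg.norm_map_le (h.tensorMap : TensorAlg k Ω x.ResidueField →+ y.ResidueField)
    zero_le_one (fun a b => by
      change ‖h.tensorMap (TensorAlg.tmul a b)‖ ≤ _
      rw [one_mul, h.tensorMap_tmul, norm_mul, h.norm_residueMap, ← evalHom_C, norm_evalHom, y.seminorm_C, coe_nnnorm]) v
  rwa [one_mul] at this

end LiesOver

end BerkovichLine

/-- The ring homomorphism `Ω[T] → Ω ⊗_k ℋ(x)` sending `T` to `1 ⊗ T(x)`. -/
def tensorEval {k : Type*} [NormedField k] (x : BerkovichLine k) (Ω : Type*) [NormedField Ω]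
    [NormedAlgebra k Ω] : (Polynomial Ω) →+* TensorAlg k Ω x.ResidueField :=
  eval₂RingHom' (TensorAlg.inl x.ResidueField) (TensorAlg.tmul 1 x.coord) fun a => by
    rw [TensorAlg.inl_apply, commute_iff_eq, TensorAlg.tmul_mul_tmul, TensorAlg.tmul_mul_tmul,
      mul_one, one_mul, one_mul, mul_one]

/-! ### Elements of Ω ⊗ ℋ(x) as limits of fractions in T(x). -/

section TensorEval

open BerkovichLine

variable {k : Type*} [NormedField k] (x : BerkovichLine k) {Ω : Type*} [NormedField Ω]
    [NormedAlgebra k Ω]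

theorem tensorEval_C (a : Ω) : tensorEval x Ω (C a) = TensorAlg.tmul a 1 := by
  simp [tensorEval, TensorAlg.inl_apply]

theorem tensorEval_X : tensorEval x Ω X = TensorAlg.tmul 1 x.coord := by
  simp [tensorEval]

theorem tensorEval_map (f : k[X]) :
    tensorEval x Ω (f.map (algebraMap k Ω)) = TensorAlg.tmul 1 (x.evalHom f) := by
  have : (tensorEval x Ω).comp (mapRingHom (algebraMap k Ω)) =
      (TensorAlg.inr Ω).comp x.evalHom := by
    refine Polynomial.ringHom_ext (fun a => ?_) ?_
    · simp only [RingHom.comp_apply, coe_mapRingHom, map_C, tensorEval_C, TensorAlg.inr_apply,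
        evalHom_C]
      have : (a • (1 : Ω)) ⊗ₜ[k] (1 : x.ResidueField) = 1 ⊗ₜ[k] (a • 1) :=
        TensorProduct.smul_tmul a _ _
      rwa [Algebra.smul_def, Algebra.smul_def, mul_one, mul_one] at this
    · simp only [RingHom.comp_apply, coe_mapRingHom, map_X, tensorEval_X, TensorAlg.inr_apply,
        evalHom_X]
  exact RingHom.congr_fun this f

theorem BerkovichLine.LiesOver.tensorMap_tensorEval {y : BerkovichLine Ω} {x : BerkovichLine k}
    (h : y.LiesOver x) (p : Polynomial Ω) : h.tensorMap (tensorEval x Ω p) = y.evalHom p := by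
  have : h.tensorMap.comp (tensorEval x Ω) = y.evalHom := by
    refine Polynomial.ringHom_ext (fun a => ?_) ?_
    · rw [RingHom.comp_apply, tensorEval_C, h.tensorMap_tmul, map_one, mul_one, evalHom_C]
    · rw [RingHom.comp_apply, tensorEval_X, h.tensorMap_tmul, map_one, one_mul, ← evalHom_X,
        h.residueMap_evalHom, map_X]
  exact RingHom.congr_fun this p

/-- Fractions in T(x) over k are dense in ℋ(x), and a sum of tensors has a common denominator in
k[T]. Statements about the seminorm of Ω ⊗ ℋ(x) thereby reduce to polynomials over Ω. -/
theorem exists_norm_sub_tensorEval_lt (v : TensorAlg k Ω x.ResidueField) :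
    ∀ ε > 0, ∃ (p : Polynomial Ω) (q : k[X]), x.evalHom q ≠ 0 ∧
      ‖v - tensorEval x Ω p * TensorAlg.tmul 1 (x.evalHom q)⁻¹‖ < ε := by
  induction v using TensorAlg.induction with
  | h0 => exact fun ε hε => ⟨0, 1, by simp, by simpa using hε⟩
  | ht a h =>
    intro ε hε
    obtain ⟨f, q, hq, hfq⟩ := x.exists_norm_sub_evalHom_div_lt h
      (show 0 < ε / (‖a‖ + 1) by positivity)
    refine ⟨C a * f.map (algebraMap k Ω), q, hq, ?_⟩
    have h1 : (TensorAlg.tmul a h : TensorAlg k Ω x.ResidueField) - tensorEval x Ω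
        (C a * f.map (algebraMap k Ω)) * TensorAlg.tmul 1 (x.evalHom q)⁻¹ =
        TensorAlg.tmul a (h - x.evalHom f * (x.evalHom q)⁻¹) := by
      rw [map_mul, tensorEval_C, tensorEval_map, TensorAlg.tmul_mul_tmul, TensorAlg.tmul_mul_tmul,
        mul_one, mul_one, one_mul, sub_eq_iff_eq_add, ← TensorAlg.tmul_add, sub_add_cancel]
    rw [h1]
    refine (TensorAlg.norm_tmul_le _ _).trans_lt ?_
    rw [lt_div_iff₀ (by positivity)] at hfq
    nlinarith [norm_nonneg (h - x.evalHom f * (x.evalHom q)⁻¹), norm_nonneg a]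
  | ha v w hv hw =>
    intro ε hε
    obtain ⟨p, q, hq, hpq⟩ := hv ε hε
    obtain ⟨p', q', hq', hpq'⟩ := hw ε hε
    refine ⟨p * q'.map (algebraMap k Ω) + p' * q.map (algebraMap k Ω), q * q', ?_, ?_⟩
    · rw [map_mul]; exact mul_ne_zero hq hq'
    · have h1 : v + w - tensorEval x Ω (p * q'.map (algebraMap k Ω) +
          p' * q.map (algebraMap k Ω)) * TensorAlg.tmul 1 (x.evalHom (q * q'))⁻¹ =
          (v - tensorEval x Ω p * TensorAlg.tmul 1 (x.evalHom q)⁻¹) +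
          (w - tensorEval x Ω p' * TensorAlg.tmul 1 (x.evalHom q')⁻¹) := by
        rw [map_add, map_mul, map_mul, map_mul, tensorEval_map, tensorEval_map, add_mul, mul_assoc,
          mul_assoc, TensorAlg.tmul_mul_tmul, TensorAlg.tmul_mul_tmul, mul_one]
        have e1 : x.evalHom q' * (x.evalHom q * x.evalHom q')⁻¹ = (x.evalHom q)⁻¹ := by
          field_simp
        have e2 : x.evalHom q * (x.evalHom q * x.evalHom q')⁻¹ = (x.evalHom q')⁻¹ := by
          field_simp
        rw [e1, e2]
        abel
      rw [h1]
      exact (IsUltrametricDist.norm_add_le_max _ _).trans_lt (max_lt hpq hpq')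

/-- The expansion of `p(T(x)) ∈ Ω ⊗_k ℋ(x)` around a point of `k`. -/
theorem tensorEval_eq_sum_taylor (c : k) (p : Polynomial Ω) {n : ℕ} (hn : p.natDegree < n) :
    tensorEval x Ω p = ∑ i ∈ Finset.range n,
      TensorAlg.tmul ((taylor (algebraMap k Ω c) p).coeff i) (x.evalHom (X - C c) ^ i) := by
  conv_lhs => rw [← sum_taylor_eq p (algebraMap k Ω c)]
  rw [sum_over_range' _ (by simp) n (by rwa [natDegree_taylor]), map_sum]
  refine Finset.sum_congr rfl fun i _ => ?_
  have h1 : (X - C (algebraMap k Ω c) : Polynomial Ω) ^ i = ((X - C c) ^ i).map (algebraMap k Ω) := by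
    simp
  rw [map_mul, tensorEval_C, h1, tensorEval_map, TensorAlg.tmul_mul_tmul, mul_one, one_mul,
    map_pow]

theorem norm_tensorEval_le (c : k) (p : Polynomial Ω) {D : ℝ} (hD : 0 ≤ D)
    (h : ∀ i, ‖(taylor (algebraMap k Ω c) p).coeff i‖ * x.seminorm (X - C c) ^ i ≤ D) :
    ‖tensorEval x Ω p‖ ≤ D := by
  rw [tensorEval_eq_sum_taylor x c p (Nat.lt_succ_self _)]
  refine IsUltrametricDist.norm_sum_le_of_forall_le_of_nonneg hD fun i _ => ?_
  refine (TensorAlg.norm_tmul_le _ _).trans ?_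
  rw [norm_pow, norm_evalHom]
  exact h i

end TensorEval

/-! ### Gauss points of discs centred at algebraic points, and the seminorm of Ω ⊗ ℋ(π(z)). -/

section Gauss

variable {Ω : Type*} [NormedField Ω] [IsUltrametricDist Ω] [CompleteSpace Ω]

variable (Ω) in
/-- The absolute value of `Ω^alg`, with real values. -/
def algClosureAbs : AbsoluteValue (AlgebraicClosure Ω) ℝ where
  toFun z := algClosureValuation Ω z
  map_mul' x y := by simp
  nonneg' z := NNReal.coe_nonneg _
  eq_zero' z := by simp
  add_le' x y := by
    exact_mod_cast ((algClosureValuation Ω).map_add x y).trans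
      (max_le_add_of_nonneg zero_le zero_le)

theorem isNonarchimedean_algClosureAbs : IsNonarchimedean (algClosureAbs Ω) := fun x y => by
  exact_mod_cast (algClosureValuation Ω).map_add x y

theorem algClosureAbs_algebraMap (a : Ω) :
    algClosureAbs Ω (algebraMap Ω (AlgebraicClosure Ω) a) = ‖a‖ := spectralNorm_extends a

theorem algClosureAbs_natCast_le_one (n : ℕ) : algClosureAbs Ω (n : AlgebraicClosure Ω) ≤ 1 := by
  have := algClosureAbs_algebraMap (n : Ω)
  rw [map_natCast] at this
  rw [this]
  exact IsUltrametricDist.norm_natCast_le_one Ω n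

theorem gaussNorm_le_of_forall {R : Type*} [Ring R] (v : AbsoluteValue R ℝ) {r D : ℝ} (p : R[X])
    (h : ∀ i, v (p.coeff i) * r ^ i ≤ D) : p.gaussNorm v r ≤ D := by
  obtain ⟨i, hi⟩ := p.exists_eq_gaussNorm v r
  exact hi ▸ h i

/-- The polynomial `p(z + T)`, for `z ∈ Ω^alg` and `p ∈ Ω[T]`. -/
def expandAt (z : AlgebraicClosure Ω) : (Polynomial Ω) →+* Polynomial (AlgebraicClosure Ω) :=
  (taylorAlgHom z : _ →ₐ[AlgebraicClosure Ω] _).toRingHom.comp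
    (mapRingHom (algebraMap Ω (AlgebraicClosure Ω)))

omit [IsUltrametricDist Ω] [CompleteSpace Ω] in
theorem expandAt_apply (z : AlgebraicClosure Ω) (p : Polynomial Ω) :
    expandAt z p = taylor z (p.map (algebraMap Ω (AlgebraicClosure Ω))) := rfl

theorem map_hasseDeriv {R S : Type*} [CommRing R] [CommRing S] (f : R →+* S) (p : R[X]) (j : ℕ) :
    (hasseDeriv j p).map f = hasseDeriv j (p.map f) := by
  ext i
  simp [hasseDeriv_coeff]

omit [IsUltrametricDist Ω] [CompleteSpace Ω] in
theorem expandAt_hasseDeriv_coeff (z : AlgebraicClosure Ω) (p : Polynomial Ω) (i j : ℕ) :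
    (expandAt z (hasseDeriv j p)).coeff i = ((i + j).choose i : AlgebraicClosure Ω) *
      (expandAt z p).coeff (i + j) := by
  rw [expandAt_apply, expandAt_apply, taylor_coeff, taylor_coeff, map_hasseDeriv]
  have := LinearMap.congr_fun (hasseDeriv_comp (R := AlgebraicClosure Ω) i j) (p.map (algebraMap Ω (AlgebraicClosure Ω)))
  rw [LinearMap.comp_apply] at this
  rw [this]
  simp

/-- The point of the affine line over `Ω` which is the image of the maximal point of the disc of
centre `z ∈ Ω^alg` and radius `r`. -/
def gaussPoint (z : AlgebraicClosure Ω) (r : ℝ≥0) (hr : 0 < r) : BerkovichLine Ω where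
  seminorm :=
    { toFun := fun p => ⟨(expandAt z p).gaussNorm (algClosureAbs Ω) r,
        gaussNorm_nonneg _ _ r.coe_nonneg⟩
      map_zero' := NNReal.eq (by
        change (expandAt z 0).gaussNorm (algClosureAbs Ω) r = 0
        simp)
      map_one' := NNReal.eq (by
        change (expandAt z 1).gaussNorm (algClosureAbs Ω) r = 1
        rw [map_one, ← C_1, gaussNorm_C, map_one])
      map_mul' := fun p q => NNReal.eq (by
        change (expandAt z (p * q)).gaussNorm (algClosureAbs Ω) r = _
        rw [map_mul]
        exact gaussNorm_mul isNonarchimedean_algClosureAbs (NNReal.coe_pos.2 hr) _ _)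
      map_add_le_max' := fun p q => by
        have := isNonarchimedean_gaussNorm (algClosureAbs Ω) isNonarchimedean_algClosureAbs
          r.coe_nonneg (expandAt z p) (expandAt z q)
        rw [← map_add] at this
        exact_mod_cast this }
  seminorm_C a := NNReal.eq (by
    change (expandAt z (C a)).gaussNorm (algClosureAbs Ω) r = ‖a‖
    rw [expandAt_apply, map_C, taylor_C, gaussNorm_C, algClosureAbs_algebraMap])

variable {z : AlgebraicClosure Ω} {r : ℝ≥0} {hr : 0 < r}

theorem gaussPoint_seminorm (p : Polynomial Ω) :
    ((gaussPoint z r hr).seminorm p : ℝ) = (expandAt z p).gaussNorm (algClosureAbs Ω) r := rfl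

theorem le_gaussPoint_seminorm (p : Polynomial Ω) (i : ℕ) :
    algClosureAbs Ω ((expandAt z p).coeff i) * r ^ i ≤ (gaussPoint z r hr).seminorm p :=
  le_gaussNorm _ _ r.coe_nonneg i

/-- Cauchy's estimate on the disc of radius r. Divided derivatives only introduce binomial
coefficients, of absolute value at most 1. -/
theorem gaussPoint_seminorm_hasseDeriv_le (p : Polynomial Ω) (j : ℕ) :
    ((gaussPoint z r hr).seminorm (hasseDeriv j p) : ℝ) * r ^ j ≤
      (gaussPoint z r hr).seminorm p := by
  rw [← le_div_iff₀ (by positivity), gaussPoint_seminorm]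
  refine gaussNorm_le_of_forall _ _ fun i => ?_
  rw [le_div_iff₀ (by positivity)]
  refine le_trans ?_ (le_gaussPoint_seminorm p (i + j))
  rw [expandAt_hasseDeriv_coeff, map_mul, mul_assoc, ← pow_add]
  exact mul_le_mul_of_nonneg_right (mul_le_of_le_one_left ((algClosureAbs Ω).nonneg _)
    (algClosureAbs_natCast_le_one _)) (by positivity)

variable {k : Type*} [NormedField k] [NormedAlgebra k Ω]

theorem projPoint_seminorm (z : AlgebraicClosure Ω) (f : k[X]) :
    ((projPoint k z).seminorm f : ℝ) = algClosureAbs Ω (aeval z f) := rfl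

theorem projPoint_seminorm_X_sub_C (z : AlgebraicClosure Ω) (c : k) :
    ((projPoint k z).seminorm (X - C c) : ℝ) =
      algClosureAbs Ω (z - algebraMap Ω (AlgebraicClosure Ω) (algebraMap k Ω c)) := by
  rw [projPoint_seminorm, map_sub, aeval_X, aeval_C, ← IsScalarTower.algebraMap_apply]

theorem BerkovichLine.radius_le (x : BerkovichLine k) (c : k) :
    x.radius ≤ x.seminorm (X - C c) :=
  ciInf_le ⟨0, by rintro _ ⟨c, rfl⟩; exact NNReal.coe_nonneg _⟩ c

/-- Over an algebraically closed field, a point of the affine line is determined by its values on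
linear polynomials. -/
theorem valuation_eq_of_X_sub_C [IsAlgClosed k] (v w : Valuation k[X] ℝ≥0)
    (hC : ∀ a, v (C a) = w (C a)) (hX : ∀ c, v (X - C c) = w (X - C c)) (f : k[X]) :
    v f = w f := by
  rw [(IsAlgClosed.splits f).eq_prod_roots, map_mul, map_mul, hC, map_multiset_prod,
    map_multiset_prod, Multiset.map_map, Multiset.map_map]
  simp only [Function.comp_def, hX]

theorem projPoint_liesOver (z : AlgebraicClosure Ω) : (projPoint Ω z).LiesOver (projPoint k z) :=
  fun f => NNReal.eq (by rw [projPoint_seminorm, projPoint_seminorm, aeval_map_algebraMap])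

/-- Since r ≤ |z - c| for every c ∈ k, the Gauss norm max(|z - c|, r) of T - c equals |z - c|.
Linear polynomials determine the point over k, so the whole disc and its centre cannot be told apart
from k. -/
theorem gaussPoint_liesOver [IsAlgClosed k] (hrz : r ≤ (projPoint k z).radius) :
    (gaussPoint z r hr).LiesOver (projPoint k z) := by
  refine valuation_eq_of_X_sub_C ((gaussPoint z r hr).seminorm.comap
    (mapRingHom (algebraMap k Ω))) _ (fun a => ?_) fun c => NNReal.eq ?_
  · rw [Valuation.comap_apply, coe_mapRingHom, map_C, (gaussPoint z r hr).seminorm_C,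
      (projPoint k z).seminorm_C, ← NNReal.coe_inj]
    exact norm_algebraMap' Ω a
  · rw [Valuation.comap_apply, coe_mapRingHom, Polynomial.map_sub, map_X, map_C]
    have hexp : expandAt z (X - C (algebraMap k Ω c)) =
        X + C (z - algebraMap Ω (AlgebraicClosure Ω) (algebraMap k Ω c)) := by
      rw [expandAt_apply, Polynomial.map_sub, map_X, map_C, map_sub, taylor_X, taylor_C, C_sub]
      ring
    apply le_antisymm
    · rw [gaussPoint_seminorm, hexp]
      refine gaussNorm_le_of_forall _ _ fun i => ?_
      rcases i with _ | _ | i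
      · simp [projPoint_seminorm_X_sub_C]
      · have : (X + C (z - algebraMap Ω (AlgebraicClosure Ω) (algebraMap k Ω c))).coeff 1 = 1 := by
          simp
        simp only [zero_add, this, map_one, one_mul, pow_one]
        exact hrz.trans (BerkovichLine.radius_le _ c)
      · simp [coeff_X]
    · have := le_gaussPoint_seminorm (z := z) (r := r) (hr := hr) (X - C (algebraMap k Ω c)) 0
      rw [hexp] at this
      simpa [projPoint_seminorm_X_sub_C] using this

/-- Recentering: the coefficients of `p` at `c` are bounded by those at `z`. -/
theorem norm_taylor_coeff_mul_pow_le (z : AlgebraicClosure Ω) (c : Ω) (p : Polynomial Ω) {s D : ℝ}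
    (hs : algClosureAbs Ω (z - algebraMap Ω (AlgebraicClosure Ω) c) = s) (hD : 0 ≤ D)
    (h : ∀ j, algClosureAbs Ω ((expandAt z p).coeff j) * s ^ j ≤ D) (i : ℕ) :
    ‖(taylor c p).coeff i‖ * s ^ i ≤ D := by
  set b := algebraMap Ω (AlgebraicClosure Ω) c - z with hb
  have hbs : algClosureAbs Ω b = s := by rw [← hs, hb, AbsoluteValue.map_sub]
  have hs0 : 0 ≤ s := hs ▸ (algClosureAbs Ω).nonneg _
  have h1 : algebraMap Ω (AlgebraicClosure Ω) ((taylor c p).coeff i) =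
      ∑ j ∈ Finset.range ((expandAt z p).natDegree + 1),
        (((expandAt z p).coeff j * (j.choose i : AlgebraicClosure Ω)) * b ^ (j - i)) := by
    rw [← coeff_map, map_taylor]
    have h2 : taylor (algebraMap Ω (AlgebraicClosure Ω) c)
        (p.map (algebraMap Ω (AlgebraicClosure Ω))) = taylor b (expandAt z p) := by
      rw [expandAt_apply, taylor_taylor, hb, sub_add_cancel]
    rw [h2, taylor_coeff, hasseDeriv_apply, sum_over_range _ (by simp), eval_finsetSum]
    exact Finset.sum_congr rfl fun j _ => by rw [eval_monomial]; ring
  rw [← algClosureAbs_algebraMap, h1]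
  have h3 : ∀ j ∈ Finset.range ((expandAt z p).natDegree + 1),
      algClosureAbs Ω (((expandAt z p).coeff j * (j.choose i : AlgebraicClosure Ω)) * b ^ (j - i))
        * s ^ i ≤ D := by
    intro j _
    rcases lt_or_ge j i with hji | hji
    · simpa [Nat.choose_eq_zero_of_lt hji] using hD
    · refine le_trans ?_ (h j)
      rw [map_mul, map_mul, map_pow, hbs, mul_assoc, ← pow_add, Nat.sub_add_cancel hji]
      exact mul_le_mul_of_nonneg_right (mul_le_of_le_one_right ((algClosureAbs Ω).nonneg _)
        (algClosureAbs_natCast_le_one _)) (by positivity)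
  obtain ⟨j, hj, hj'⟩ := IsNonarchimedean.finset_image_add_of_nonempty
    (isNonarchimedean_algClosureAbs (Ω := Ω)) (fun j => ((expandAt z p).coeff j * (j.choose i : AlgebraicClosure Ω)) * b ^ (j - i))
    (Finset.nonempty_range_add_one (n := (expandAt z p).natDegree))
  exact (mul_le_mul_of_nonneg_right hj' (by positivity)).trans (h3 j hj)

/-- The infimum defining r may not be attained. For each s > r a centre c ∈ k with r ≤ |z - c| < s
is used in place of z; the loss is a factor (s/r) to the power of the degree, which tends to 1 as s
tends to r. -/
theorem norm_tensorEval_le_gaussPoint (hrz : r = (projPoint k z).radius)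
    (p : Polynomial Ω) :
    ‖tensorEval (projPoint k z) Ω p‖ ≤ (gaussPoint z r hr).seminorm p := by
  have hr' : (0 : ℝ) < r := NNReal.coe_pos.2 hr
  obtain ⟨Y, hY⟩ : ∃ Y : ℝ, Y = ((gaussPoint z r hr).seminorm p : ℝ) := ⟨_, rfl⟩
  have hY0 : 0 ≤ Y := hY ▸ NNReal.coe_nonneg _
  rw [← hY]
  have key : ∀ s ∈ Set.Ioi (r : ℝ),
      ‖tensorEval (projPoint k z) Ω p‖ ≤ Y * (s / r) ^ (expandAt z p).natDegree := by
    intro s hs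
    have hs' : (projPoint k z).radius < s := hrz ▸ hs
    obtain ⟨c, hc⟩ := exists_lt_of_ciInf_lt hs'
    have hrc : (r : ℝ) ≤ (projPoint k z).seminorm (X - C c) := hrz ▸ BerkovichLine.radius_le _ c
    refine norm_tensorEval_le _ c p (by have : 0 < s := hr'.trans hs; positivity) ?_
    refine norm_taylor_coeff_mul_pow_le z _ p (projPoint_seminorm_X_sub_C z c).symm
      (by have : 0 < s := hr'.trans hs; positivity) fun j => ?_
    rcases lt_or_ge (expandAt z p).natDegree j with hj | hj
    · rw [coeff_eq_zero_of_natDegree_lt hj, map_zero, zero_mul]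
      have : 0 < s := hr'.trans hs
      positivity
    · have h1 : ((projPoint k z).seminorm (X - C c) : ℝ) ^ j ≤
          r ^ j * (s / r) ^ (expandAt z p).natDegree := by
        calc ((projPoint k z).seminorm (X - C c) : ℝ) ^ j ≤ s ^ j :=
              pow_le_pow_left₀ (NNReal.coe_nonneg _) hc.le _
          _ = r ^ j * (s / r) ^ j := by rw [← mul_pow, mul_div_cancel₀ _ hr'.ne']
          _ ≤ _ := by
              gcongr
              exact (one_le_div hr').2 (le_of_lt hs)
      calc _ ≤ algClosureAbs Ω ((expandAt z p).coeff j) *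
            (r ^ j * (s / r) ^ (expandAt z p).natDegree) :=
              mul_le_mul_of_nonneg_left h1 ((algClosureAbs Ω).nonneg _)
        _ = (algClosureAbs Ω ((expandAt z p).coeff j) * r ^ j) *
            (s / r) ^ (expandAt z p).natDegree := (mul_assoc _ _ _).symm
        _ ≤ _ := mul_le_mul_of_nonneg_right (hY ▸ le_gaussPoint_seminorm p j)
              (by have : 0 < s := hr'.trans hs; positivity)
  have hlim : Filter.Tendsto (fun s : ℝ => Y * (s / r) ^ (expandAt z p).natDegree)
      (nhdsWithin (r : ℝ) (Set.Ioi r)) (nhds Y) := by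
    have : Continuous fun s : ℝ => Y * (s / r) ^ (expandAt z p).natDegree := by fun_prop
    have h2 := (this.tendsto r).mono_left (nhdsWithin_le_nhds (s := Set.Ioi (r : ℝ)))
    simpa [div_self hr'.ne'] using h2
  exact ge_of_tendsto hlim (Filter.eventually_of_mem self_mem_nhdsWithin key)

/-- For `x = π(z)` of positive radius `r`, the tensor seminorm on `Ω ⊗_k ℋ(x)` is the Gauss norm
of the disc of centre `z` and radius `r`; in particular it is multiplicative. -/
theorem norm_tensorMap_gaussPoint [IsAlgClosed k] (hrz : r = (projPoint k z).radius)
    (v : TensorAlg k Ω (projPoint k z).ResidueField) :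
    ‖(gaussPoint_liesOver (hr := hr) hrz.le).tensorMap v‖ = ‖v‖ := by
  set h := gaussPoint_liesOver (hr := hr) hrz.le
  refine le_antisymm (h.norm_tensorMap_le v) ?_
  refine le_of_forall_pos_le_add fun ε hε => ?_
  -- The inequality is direct for a fraction w = p(T(x))/q(T(x)), because the denominator lies in
  -- ℋ(x), where norms are preserved. Both v and its image change by at most ε when v is replaced by
  -- w.
  obtain ⟨p, q, -, hpq⟩ := exists_norm_sub_tensorEval_lt (projPoint k z) v ε hε
  set w := tensorEval (projPoint k z) Ω p * TensorAlg.tmul 1 ((projPoint k z).evalHom q)⁻¹ with hw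
  have h1 : ‖w‖ ≤ ‖h.tensorMap w‖ := by
    have h5 : ‖h.tensorMap w‖ = (gaussPoint z r hr).seminorm p *
        ‖((projPoint k z).evalHom q)⁻¹‖ := by
      rw [hw, map_mul, h.tensorMap_tensorEval, h.tensorMap_tmul, map_one, one_mul, norm_mul,
        BerkovichLine.norm_evalHom, h.norm_residueMap]
    rw [h5, hw]
    refine (norm_mul_le _ _).trans ?_
    gcongr
    · exact norm_tensorEval_le_gaussPoint hrz p
    · exact (TensorAlg.norm_tmul_le _ _).trans (by rw [norm_one, one_mul])
  have h2 : ‖w‖ ≤ max ‖h.tensorMap v‖ ε := by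
    refine h1.trans ?_
    have h3 : h.tensorMap w = h.tensorMap v + h.tensorMap (-(v - w)) := by
      rw [← map_add]; congr 1; abel
    rw [h3]
    refine (IsUltrametricDist.norm_add_le_max _ _).trans (max_le_max le_rfl ?_)
    exact (h.norm_tensorMap_le _).trans (by rw [norm_neg]; exact hpq.le)
  have h4 : v = (v - w) + w := by abel
  rw [h4]
  refine (IsUltrametricDist.norm_add_le_max _ _).trans ?_
  have := norm_nonneg (h.tensorMap v)
  rw [← h4]
  refine max_le (by linarith) (h2.trans (max_le (by linarith) (by linarith)))

end Gauss

/-! ### Cyclic bases of differential modules -/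

section Frame

variable {k Ω : Type*} [Field k] [Field Ω] [Algebra k Ω] {d : Derivation k Ω Ω}

/-- A basis `s₀, …, sₙ₋₁` of `M`, with coordinates `λ₀, …, λₙ₋₁`, in which the connection is given
by the companion matrix of `P`. (The values at indices `≥ n` are irrelevant.) -/
structure CyclicFrame {M : Type*} [AddCommGroup M] [Module Ω M] [Module k M]
    (D : Connection d M) (P : Polynomial Ω) where
  /-- the basis -/
  s : ℕ → M
  /-- the coordinates -/
  coord : ℕ → M →ₗ[Ω] Ω
  sum_coord : ∀ m, ∑ i ∈ Finset.range P.natDegree, coord i m • s i = m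
  coord_s : ∀ i < P.natDegree, ∀ j < P.natDegree, coord j (s i) = if i = j then 1 else 0
  apply_s : ∀ i, i + 1 < P.natDegree → D.toLinearMap (s i) = s (i + 1)
  apply_s_last : 0 < P.natDegree → D.toLinearMap (s (P.natDegree - 1)) =
    -∑ i ∈ Finset.range P.natDegree, P.coeff i • s i

theorem delta_coeff_succ (Q : Polynomial Ω) (j : ℕ) :
    (DiffPoly.delta d Q).coeff (j + 1) = d (Q.coeff (j + 1)) + Q.coeff j := by
  induction Q using Polynomial.induction_on' with
  | add p q hp hq => simp only [map_add, coeff_add, hp, hq]; abel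
  | monomial i a =>
    rw [DiffPoly.delta_monomial, coeff_add, coeff_monomial, coeff_monomial, coeff_monomial,
      coeff_monomial]
    simp only [add_left_inj]
    split_ifs <;> simp

/-- Left multiplication by d raises the degree by one and keeps the leading coefficient 1; the term
d(1) = 0 does not interfere. -/
theorem delta_pow_coeff {P : Polynomial Ω} (hP : P.Monic) (i : ℕ) :
    ((DiffPoly.delta d ^ i) P).coeff (P.natDegree + i) = 1 ∧
      ∀ j, P.natDegree + i < j → ((DiffPoly.delta d ^ i) P).coeff j = 0 := by
  induction i with
  | zero => exact ⟨hP, fun j hj => coeff_eq_zero_of_natDegree_lt hj⟩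
  | succ i ih =>
    rw [pow_succ', Module.End.mul_apply, ← add_assoc]
    constructor
    · rw [delta_coeff_succ, ih.1, ih.2 _ (Nat.lt_succ_self _), map_zero, zero_add]
    · rintro (_ | j) hj
      · omega
      · rw [delta_coeff_succ, ih.2 _ (by omega), ih.2 _ (by omega), map_zero, zero_add]

/-- Degrees add in products with a monic right factor, so a nonzero left multiple of P(d) has degree
at least that of P. This is what makes the classes of the low powers of d independent. -/
theorem leftMul_coeff {P : Polynomial Ω} (hP : P.Monic) (Q : Polynomial Ω) :
    (DiffPoly.leftMul d Q P).coeff (P.natDegree + Q.natDegree) = Q.leadingCoeff := by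
  have h1 : DiffPoly.leftMul d Q P = ∑ i ∈ Finset.range (Q.natDegree + 1),
      Q.coeff i • (DiffPoly.delta d ^ i) P := by
    conv_lhs => rw [Q.as_sum_range]
    rw [map_sum, LinearMap.sum_apply]
    exact Finset.sum_congr rfl fun i _ => by rw [DiffPoly.leftMul_monomial, LinearMap.smul_apply]
  rw [h1, finsetSum_coeff, Finset.sum_range_succ, coeff_smul, (delta_pow_coeff hP _).1,
    Finset.sum_eq_zero fun i hi => ?_]
  · simp
  · rw [coeff_smul, (delta_pow_coeff hP i).2 _ (by have := Finset.mem_range.1 hi; omega), smul_zero]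

variable (d) in
/-- The class of `dⁱ` in `𝒟 / 𝒟 P(d)`. -/
def cyclicPow (P : Polynomial Ω) (i : ℕ) : CyclicModule d P :=
  Submodule.Quotient.mk (DiffPoly.ofPoly d (X ^ i))

theorem cyclicConnection_mk (P : Polynomial Ω) (Q : DiffPoly d) :
    (cyclicConnection d P).toLinearMap (Submodule.Quotient.mk Q) =
      Submodule.Quotient.mk (DiffPoly.var d * Q) := rfl

theorem cyclicConnection_cyclicPow (P : Polynomial Ω) (i : ℕ) :
    (cyclicConnection d P).toLinearMap (cyclicPow d P i) = cyclicPow d P (i + 1) := by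
  rw [cyclicPow, cyclicConnection_mk, ← DiffPoly.var_pow, ← pow_succ', DiffPoly.var_pow]
  rfl

theorem mk_sum_smul (P : Polynomial Ω) (n : ℕ) (c : ℕ → Ω) :
    (Submodule.Quotient.mk (DiffPoly.ofPoly d (∑ i ∈ Finset.range n, C (c i) * X ^ i)) :
      CyclicModule d P) = ∑ i ∈ Finset.range n, c i • cyclicPow d P i := by
  induction n with
  | zero => rfl
  | succ n ih =>
    rw [Finset.sum_range_succ, Finset.sum_range_succ, map_add, Submodule.Quotient.mk_add, ih,
      ← smul_eq_C_mul, map_smul]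
    rfl

theorem cyclicPow_natDegree {P : Polynomial Ω} (hP : P.Monic) :
    cyclicPow d P P.natDegree =
      -∑ i ∈ Finset.range P.natDegree, P.coeff i • cyclicPow d P i := by
  have h1 : (Submodule.Quotient.mk (DiffPoly.ofPoly d P) : CyclicModule d P) = 0 :=
    (Submodule.Quotient.mk_eq_zero _).2 (Ideal.subset_span rfl)
  have h2 : (Submodule.Quotient.mk (DiffPoly.ofPoly d P) : CyclicModule d P) =
      cyclicPow d P P.natDegree +
        Submodule.Quotient.mk (DiffPoly.ofPoly d
          (∑ i ∈ Finset.range P.natDegree, C (P.coeff i) * X ^ i)) :=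
    congrArg (fun Q => (Submodule.Quotient.mk (DiffPoly.ofPoly d Q) : CyclicModule d P)) hP.as_sum
  refine eq_neg_of_add_eq_zero_left ?_
  rw [← mk_sum_smul, ← h2, h1]

/-- By the Leibniz rule the span is stable under the connection as soon as the images of its
generators lie in it; only the last generator needs the relation P(d) = 0. -/
theorem cyclicPow_mem_span {P : Polynomial Ω} (hP : P.Monic) (j : ℕ) :
    cyclicPow d P j ∈ Submodule.span Ω (Set.range fun i : Fin P.natDegree => cyclicPow d P i) := by
  set S := Submodule.span Ω (Set.range fun i : Fin P.natDegree => cyclicPow d P i) with hS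
  have hlt : ∀ i < P.natDegree, cyclicPow d P i ∈ S := fun i hi =>
    Submodule.subset_span ⟨⟨i, hi⟩, rfl⟩
  have hn : cyclicPow d P P.natDegree ∈ S := by
    rw [cyclicPow_natDegree hP]
    exact S.neg_mem (S.sum_mem fun i hi => S.smul_mem _ (hlt i (Finset.mem_range.1 hi)))
  have hstable : ∀ m ∈ S, (cyclicConnection d P).toLinearMap m ∈ S := by
    intro m hm
    induction hm using Submodule.span_induction with
    | mem m hm =>
      obtain ⟨i, rfl⟩ := hm
      rw [cyclicConnection_cyclicPow]
      rcases Nat.lt_or_ge (i + 1) P.natDegree with h | h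
      · exact hlt _ h
      · rwa [show (i : ℕ) + 1 = P.natDegree by have := i.2; omega]
    | zero => rw [map_zero]; exact S.zero_mem
    | add x y _ _ hx hy => rw [map_add]; exact S.add_mem hx hy
    | smul a x hx' hx =>
      rw [(cyclicConnection d P).leibniz]
      exact S.add_mem (S.smul_mem _ hx') (S.smul_mem _ hx)
  induction j with
  | zero =>
    rcases Nat.eq_zero_or_pos P.natDegree with h | h
    · rwa [h] at hn
    · exact hlt _ h
  | succ j ih =>
    rw [← cyclicConnection_cyclicPow]
    exact hstable _ ih

theorem linearIndependent_cyclicPow {P : Polynomial Ω} (hP : P.Monic) :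
    LinearIndependent Ω fun i : Fin P.natDegree => cyclicPow d P i := by
  rw [Fintype.linearIndependent_iff]
  intro g hg
  let c : ℕ → Ω := fun i => if h : i < P.natDegree then g ⟨i, h⟩ else 0
  have hcg (i : Fin P.natDegree) : c i = g i := dif_pos i.2
  have hsum : ∑ i ∈ Finset.range P.natDegree, c i • cyclicPow d P i = 0 := by
    rw [Finset.sum_range]
    simpa only [hcg] using hg
  rw [← mk_sum_smul, Submodule.Quotient.mk_eq_zero, Ideal.mem_span_singleton'] at hsum
  obtain ⟨Q, hQ⟩ := hsum
  obtain ⟨Q, rfl⟩ := (DiffPoly.ofPoly d).surjective Q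
  have hQ' : DiffPoly.leftMul d Q P = ∑ i ∈ Finset.range P.natDegree, C (c i) * X ^ i := hQ
  have hcoeff (j : ℕ) : (∑ i ∈ Finset.range P.natDegree, C (c i) * X ^ i).coeff j =
      if j < P.natDegree then c j else 0 := by
    simp [coeff_X_pow]
  -- The multiple Q · P(d) has degree less than P, so its coefficient in degree deg P + deg Q, which
  -- is the leading coefficient of Q, vanishes.
  have hQ0 : Q = 0 := by
    rw [← leadingCoeff_eq_zero, ← leftMul_coeff (d := d) hP Q, hQ', hcoeff, if_neg (by omega)]
  intro i
  rw [hQ0, map_zero, LinearMap.zero_apply] at hQ'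
  have := hcoeff i
  rw [← hQ', if_pos i.2, hcg, coeff_zero] at this
  exact this.symm

theorem exists_cyclicFrame {M : Type*} [AddCommGroup M] [Module Ω M] [Module k M]
    {D : Connection d M} {P : Polynomial Ω} (hP : P.Monic)
    (hDP : D.IsIsomorphic (cyclicConnection d P)) : Nonempty (CyclicFrame D P) := by
  obtain ⟨e, he⟩ := hDP
  have hspan : ⊤ ≤ Submodule.span Ω (Set.range fun i : Fin P.natDegree => cyclicPow d P i) := by
    rintro m -
    obtain ⟨Q, rfl⟩ := Submodule.Quotient.mk_surjective _ m
    obtain ⟨Q, rfl⟩ := (DiffPoly.ofPoly d).surjective Q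
    rw [Q.as_sum_range_C_mul_X_pow, mk_sum_smul]
    exact Submodule.sum_mem _ fun i _ => Submodule.smul_mem _ _ (cyclicPow_mem_span hP i)
  let b := Module.Basis.mk (linearIndependent_cyclicPow (d := d) hP) hspan
  have hb (i : Fin P.natDegree) : b i = cyclicPow d P i := Module.Basis.mk_apply _ _ i
  have hD (m : CyclicModule d P) : D.toLinearMap (e.symm m) =
      e.symm ((cyclicConnection d P).toLinearMap m) := by
    rw [LinearEquiv.eq_symm_apply, he, LinearEquiv.apply_symm_apply]
  refine ⟨⟨fun i => e.symm (cyclicPow d P i),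
    fun j => if h : j < P.natDegree then b.coord ⟨j, h⟩ ∘ₗ e.toLinearMap else 0, fun m => ?_,
    fun i hi j hj => ?_, fun i hi => ?_, fun h0 => ?_⟩⟩
  · rw [Finset.sum_range]
    apply e.injective
    rw [map_sum]
    conv_rhs => rw [← b.sum_repr (e m)]
    refine Finset.sum_congr rfl fun i _ => ?_
    rw [map_smul, e.apply_symm_apply, dif_pos i.2, hb]
    rfl
  · rw [dif_pos hj, LinearMap.comp_apply, LinearEquiv.coe_coe, e.apply_symm_apply,
      ← hb ⟨i, hi⟩, Module.Basis.coord_apply, Module.Basis.repr_self, Finsupp.single_apply]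
    simp
  · rw [hD, cyclicConnection_cyclicPow]
  · rw [hD, cyclicConnection_cyclicPow, Nat.sub_add_cancel h0, cyclicPow_natDegree hP, map_neg,
      map_sum]
    simp

namespace CyclicFrame

variable {M : Type*} [AddCommGroup M] [Module Ω M] [Module k M] {D : Connection d M}
  {P : Polynomial Ω} (F : CyclicFrame D P)

include F

theorem coord_sum (c : ℕ → Ω) {j : ℕ} (hj : j < P.natDegree) :
    F.coord j (∑ i ∈ Finset.range P.natDegree, c i • F.s i) = c j := by
  rw [map_sum, Finset.sum_eq_single j]
  · simp [F.coord_s j hj j hj]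
  · intro i hi hij
    simp [F.coord_s i (Finset.mem_range.1 hi) j hj, hij]
  · intro h
    exact absurd (Finset.mem_range.2 hj) h

/-- Expand m in the frame and apply the Leibniz rule: the companion matrix shifts the coordinates
and feeds the last one, of index n = deg P - 1, back through the coefficients of P. -/
theorem apply_eq {n : ℕ} (hn : P.natDegree = n + 1) (m : M) :
    D.toLinearMap m = ∑ i ∈ Finset.range P.natDegree,
      (d (F.coord i m) + (if i = 0 then 0 else F.coord (i - 1) m) -
        P.coeff i * F.coord n m) • F.s i := by
  have h1 : D.toLinearMap m = ∑ i ∈ Finset.range P.natDegree, d (F.coord i m) • F.s i +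
      ∑ i ∈ Finset.range P.natDegree, F.coord i m • D.toLinearMap (F.s i) := by
    conv_lhs => rw [← F.sum_coord m]
    rw [map_sum, ← Finset.sum_add_distrib]
    exact Finset.sum_congr rfl fun i _ => D.leibniz _ _
  have hlast := F.apply_s_last (by omega)
  have h2 : ∑ i ∈ Finset.range P.natDegree, F.coord i m • D.toLinearMap (F.s i) =
      ∑ i ∈ Finset.range P.natDegree, (if i = 0 then 0 else F.coord (i - 1) m) • F.s i -
        ∑ i ∈ Finset.range P.natDegree, (P.coeff i * F.coord n m) • F.s i := by
    have h3 : ∑ i ∈ Finset.range P.natDegree, (P.coeff i * F.coord n m) • F.s i =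
        -(F.coord n m • D.toLinearMap (F.s n)) := by
      rw [hn, Nat.add_sub_cancel] at hlast
      rw [hlast, smul_neg, neg_neg, hn, Finset.smul_sum]
      exact Finset.sum_congr rfl fun i _ => by rw [mul_comm, mul_smul]
    rw [h3, sub_neg_eq_add, hn, Finset.sum_range_succ, Finset.sum_range_succ' _ n]
    simp only [if_true, zero_smul, add_zero, Nat.add_eq_zero_iff, one_ne_zero, and_false, if_false,
      Nat.add_sub_cancel]
    congr 1
    exact Finset.sum_congr rfl fun i hi => by
      rw [F.apply_s i (by have := Finset.mem_range.1 hi; omega)]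
  rw [h1, h2]
  simp only [add_smul, sub_smul, Finset.sum_add_distrib, Finset.sum_sub_distrib]
  abel

theorem coord_apply_zero {n : ℕ} (hn : P.natDegree = n + 1) (m : M) :
    F.coord 0 (D.toLinearMap m) = d (F.coord 0 m) - P.coeff 0 * F.coord n m := by
  rw [F.apply_eq hn, F.coord_sum _ (by omega)]
  simp

theorem coord_apply_succ {n : ℕ} (hn : P.natDegree = n + 1) {j : ℕ} (hj : j + 1 < P.natDegree)
    (m : M) : F.coord (j + 1) (D.toLinearMap m) =
      d (F.coord (j + 1) m) + F.coord j m - P.coeff (j + 1) * F.coord n m := by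
  rw [F.apply_eq hn, F.coord_sum _ hj]
  simp

end CyclicFrame

end Frame

/-! ### Boundedness -/

section Bounded

/-- A linear form on a finite-dimensional normed space over a complete ultrametric field, possibly
trivially valued, is bounded. -/
theorem isBoundedOp_linearForm {Ω M : Type*} [NormedField Ω] [CompleteSpace Ω]
    [NormedAddCommGroup M] [IsUltrametricDist M] [NormedSpace Ω M] [FiniteDimensional Ω M]
    (f : M →ₗ[Ω] Ω) : IsBoundedOp f := by
  by_cases h : ∃ a : Ω, a ≠ 0 ∧ ‖a‖ ≠ 1
  · let _ : NontriviallyNormedField Ω := NontriviallyNormedField.ofNormNeOne h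
    exact ⟨‖LinearMap.toContinuousLinearMap f‖,
      fun m => (LinearMap.toContinuousLinearMap f).le_opNorm m⟩
  · push Not at h
    have hle : ∀ a : Ω, ‖a‖ ≤ 1 := fun a => by
      by_cases ha : a = 0
      · simp [ha]
      · exact (h a ha).le
    -- In the trivially valued case balls are Ω-subspaces, since scalars have norm at most 1. A
    -- decreasing sequence of balls with radii tending to 0 stabilises by finite dimension, and its
    -- limit is 0; nonzero vectors therefore have norm bounded below, while f takes values of norm
    -- at most 1.
    let W : ℕ → Submodule Ω M := fun i =>
      { carrier := {m | ‖m‖ ≤ 1 / ((i : ℝ) + 1)}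
        add_mem' := fun ha hb => (IsUltrametricDist.norm_add_le_max _ _).trans (max_le ha hb)
        zero_mem' := by simp only [Set.mem_ofPred_eq, norm_zero]; positivity
        smul_mem' := fun c m hm => (norm_smul_le c m).trans
          ((mul_le_of_le_one_left (norm_nonneg m) (hle c)).trans hm) }
    have hW : Antitone W := fun i j hij m (hm : ‖m‖ ≤ _) =>
      hm.trans (one_div_le_one_div_of_le (by positivity) (by gcongr))
    obtain ⟨i, hi⟩ := IsArtinian.monotone_stabilizes (⟨W, hW⟩ : ℕ →o (Submodule Ω M)ᵒᵈ)
    have hsmall : ∀ m ∈ W i, m = 0 := by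
      intro m hm
      by_contra hne
      obtain ⟨j, hj⟩ := exists_nat_one_div_lt (norm_pos_iff.2 hne)
      have h1 : m ∈ W (max i j) := by
        have : W i = W (max i j) := hi (max i j) (le_max_left _ _)
        exact this ▸ hm
      have h2 : m ∈ W j := hW (le_max_right i j) h1
      exact absurd hj (not_lt.2 h2)
    refine ⟨(i : ℝ) + 1, fun m => ?_⟩
    by_cases hm : m = 0
    · simp [hm]
    · have h1 : ¬ ‖m‖ ≤ 1 / ((i : ℝ) + 1) := fun hle' => hm (hsmall m hle')
      rw [not_le, div_lt_iff₀ (by positivity)] at h1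
      exact (hle _).trans (by linarith)

end Bounded

/-! ### Approximation in ultrametric groups and completed rings -/

section Approximation

/-- The error is relative to v, so a bound on v comes first: ‖v‖ > 1 would contradict v = (u + o) -
o - (u - v), as all three terms would be smaller than v. Then ‖u - v‖ ≤ q < 1. -/
theorem norm_add_lt_one_of_approx {G : Type*} [SeminormedAddCommGroup G] [IsUltrametricDist G]
    {u v o : G} {q : ℝ} (ho : ‖o‖ = 1) (hu : ‖u + o‖ < 1) (hq0 : 0 ≤ q) (hq : q < 1)
    (huv : ‖u - v‖ ≤ q * ‖v‖) : ‖v + o‖ < 1 := by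
  have huv' : ‖-(u - v)‖ ≤ q * ‖v‖ := by rwa [norm_neg]
  have hv : ‖v‖ ≤ 1 := by
    by_contra! hv
    have h2 : ‖v‖ ≤ max 1 (q * ‖v‖) := by
      have e : v = (u + o) + (-o + -(u - v)) := by abel
      conv_lhs => rw [e]
      refine (IsUltrametricDist.norm_add_le_max _ _).trans
        (max_le (hu.le.trans (le_max_left _ _)) ?_)
      exact (IsUltrametricDist.norm_add_le_max _ _).trans
        (max_le_max (by rw [norm_neg, ho]) huv')
    rcases le_max_iff.1 h2 with h3 | h3
    · linarith
    · nlinarith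
  have e : v + o = (u + o) + -(u - v) := by abel
  rw [e]
  refine (IsUltrametricDist.norm_add_le_max _ _).trans_lt (max_lt hu (huv'.trans_lt ?_))
  nlinarith [norm_nonneg v]

/-- Truncating a right inverse brings the computation back to the uncompleted tensor product, where
base changes of linear forms are defined. -/
theorem exists_approx_right_inverse {A : Type*} [SeminormedRing A] {a : A}
    (ha : IsUnit (a : UniformSpace.Completion A)) {ε : ℝ} (hε : 0 < ε) :
    ∃ b : A, ‖a * b - 1‖ < ε := by
  obtain ⟨b, hab⟩ := ha.exists_right_inv
  obtain ⟨c, hc⟩ := (UniformSpace.Completion.denseRange_coe (α := A)).exists_dist_lt b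
    (show 0 < ε / (‖a‖ + 1) by positivity)
  refine ⟨c, ?_⟩
  have h1 : ((a * c - 1 : A) : UniformSpace.Completion A) = -(a * (b - c)) := by
    rw [mul_sub, hab, UniformSpace.Completion.coe_sub, UniformSpace.Completion.coe_mul,
      UniformSpace.Completion.coe_one]
    abel
  rw [← UniformSpace.Completion.norm_coe, h1, norm_neg]
  refine (norm_mul_le _ _).trans_lt ?_
  rw [UniformSpace.Completion.norm_coe]
  rw [dist_eq_norm, lt_div_iff₀ (by positivity)] at hc
  nlinarith [norm_nonneg ((b : UniformSpace.Completion A) - c), norm_nonneg a]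

end Approximation

/-! ### Differential operators on `Ω ⊗ ℋ(x)` -/

section TensorOperators

variable {k : Type*} [NormedField k] {Ω : Type*} [NormedField Ω] [NormedAlgebra k Ω]
  (x : BerkovichLine k) (d : Derivation k Ω Ω)

/-- The derivation `d ⊗ 1` of `Ω ⊗ ℋ(x)`. -/
def tensorDeriv : Module.End ℤ (TensorAlg k Ω x.ResidueField) :=
  (TensorAlg.map (d : Ω →ₗ[k] Ω)).toIntLinearMap

theorem tensorDeriv_tmul (a : Ω) (h : x.ResidueField) :
    tensorDeriv x d (TensorAlg.tmul a h) = TensorAlg.tmul (d a) h := rfl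

variable (Ω) in
/-- Multiplication by `p(T(x))` on `Ω ⊗ ℋ(x)`, for `p ∈ Ω[T]`. -/
def tensorMulEval : (Polynomial Ω) →+* Module.End ℤ (TensorAlg k Ω x.ResidueField) :=
  (Algebra.lmul ℤ (TensorAlg k Ω x.ResidueField)).toRingHom.comp (tensorEval x Ω)

theorem tensorMulEval_apply (p : Polynomial Ω) (v : TensorAlg k Ω x.ResidueField) :
    tensorMulEval Ω x p v = tensorEval x Ω p * v := rfl

theorem commute_tensorDeriv : Commute (tensorDeriv x d) (tensorMulEval Ω x X) := by
  refine LinearMap.ext fun v => ?_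
  rw [Module.End.mul_apply, Module.End.mul_apply, tensorMulEval_apply, tensorMulEval_apply,
    tensorEval_X]
  induction v using TensorAlg.induction with
  | h0 => simp
  | ht a h => simp only [TensorAlg.tmul_mul_tmul, tensorDeriv_tmul, one_mul]
  | ha v w hv hw => rw [mul_add, map_add, hv, hw, map_add, mul_add]

variable {d} (hd : IsBoundedOp d)

include hd in
theorem norm_tensorDeriv_pow_le (j : ℕ) (v : TensorAlg k Ω x.ResidueField) :
    ‖((-tensorDeriv x d) ^ j) v‖ ≤ opNorm d ^ j * ‖v‖ := by
  induction j with
  | zero => simp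
  | succ j ih =>
    rw [pow_succ', Module.End.mul_apply, LinearMap.neg_apply, norm_neg, pow_succ', mul_assoc]
    refine (TensorAlg.norm_map_apply_le (d : Ω →ₗ[k] Ω) (opNorm_nonneg d) hd.le_opNorm _).trans ?_
    exact mul_le_mul_of_nonneg_left ih (opNorm_nonneg d)

include hd in
theorem exists_norm_sub_tensorDeriv_pow_le (j : ℕ) : ∃ C : ℝ, 0 ≤ C ∧
    ∀ v, ‖((tensorMulEval Ω x X - tensorDeriv x d) ^ j) v‖ ≤ C * ‖v‖ := by
  induction j with
  | zero => exact ⟨1, zero_le_one, fun v => by simp⟩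
  | succ j ih =>
    obtain ⟨C, hC, h⟩ := ih
    refine ⟨(‖tensorEval x Ω X‖ + opNorm d) * C,
      mul_nonneg (add_nonneg (norm_nonneg _) (opNorm_nonneg d)) hC, fun v => ?_⟩
    rw [pow_succ', Module.End.mul_apply, LinearMap.sub_apply, tensorMulEval_apply, mul_assoc]
    refine (norm_sub_le _ _).trans ?_
    have h1 := norm_tensorDeriv_pow_le x hd 1
      (((tensorMulEval Ω x X - tensorDeriv x d) ^ j) v)
    rw [pow_one, pow_one, LinearMap.neg_apply, norm_neg] at h1
    calc _ ≤ (‖tensorEval x Ω X‖ + opNorm d) *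
          ‖((tensorMulEval Ω x X - tensorDeriv x d) ^ j) v‖ := by
          rw [add_mul]
          exact add_le_add (norm_mul_le _ _) h1
      _ ≤ _ := mul_le_mul_of_nonneg_left (h v)
          (add_nonneg (norm_nonneg _) (opNorm_nonneg d))

end TensorOperators

/-! ### Points below a root: the adjoint operator stays away from -1. -/

section Root

variable {k : Type*} [NormedField k] [IsAlgClosed k] {Ω : Type*} [NormedField Ω]
  [IsUltrametricDist Ω] [CompleteSpace Ω] [NormedAlgebra k Ω] {d : Derivation k Ω Ω}
  (hd : IsBoundedOp d) {z : AlgebraicClosure Ω}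

theorem norm_tensorEval_mul {r : ℝ≥0} (hr : 0 < r) (hrz : r = (projPoint k z).radius)
    (p : Polynomial Ω) (v : TensorAlg k Ω (projPoint k z).ResidueField) :
    ‖tensorEval (projPoint k z) Ω p * v‖ = (gaussPoint z r hr).seminorm p * ‖v‖ := by
  rw [← norm_tensorMap_gaussPoint (hr := hr) hrz, map_mul,
    BerkovichLine.LiesOver.tensorMap_tensorEval, norm_mul, norm_tensorMap_gaussPoint hrz,
    BerkovichLine.norm_evalHom]

omit [IsAlgClosed k] [IsUltrametricDist Ω] [CompleteSpace Ω] in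
include hd in
-- The term of index j ≥ 1 is at most (‖d‖/r)ʲ ‖P(T(x)) y‖: each derivation costs ‖d‖ and Cauchy's
-- estimate gains rʲ. The ultrametric inequality keeps only the largest ratio, that of j = 1.
theorem norm_adjoint_sub_le {x : BerkovichLine k} {Y : Polynomial Ω → ℝ} {r : ℝ}
    (hdr : opNorm d < r) (hY : ∀ p v, ‖tensorEval x Ω p * v‖ = Y p * ‖v‖)
    (hYr : ∀ p j, Y (hasseDeriv j p) * r ^ j ≤ Y p)
    (P : Polynomial Ω) (n : ℕ) (y : TensorAlg k Ω x.ResidueField) :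
    ‖(∑ j ∈ Finset.range (n + 1), (-tensorDeriv x d) ^ j *
      tensorMulEval Ω x (hasseDeriv j P)) y - tensorEval x Ω P * y‖ ≤
        opNorm d / r * ‖tensorEval x Ω P * y‖ := by
  have hr : 0 < r := (opNorm_nonneg d).trans_lt hdr
  have hq0 : 0 ≤ opNorm d / r := div_nonneg (opNorm_nonneg d) hr.le
  have hq1 : opNorm d / r < 1 := (div_lt_one hr).2 hdr
  rw [LinearMap.sum_apply, Finset.sum_range_succ']
  simp only [Module.End.mul_apply, tensorMulEval_apply, pow_zero, hasseDeriv_zero,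
    LinearMap.id_apply, Module.End.one_apply, add_sub_cancel_right]
  refine IsUltrametricDist.norm_sum_le_of_forall_le_of_nonneg
    (mul_nonneg hq0 (norm_nonneg _)) fun j _ => ?_
  refine (norm_tensorDeriv_pow_le x hd _ _).trans ?_
  rw [hY, hY]
  have h1 : opNorm d ^ (j + 1) = (opNorm d / r) ^ (j + 1) * r ^ (j + 1) := by
    rw [← mul_pow, div_mul_cancel₀ _ hr.ne']
  have h2 : (opNorm d / r) ^ (j + 1) ≤ opNorm d / r :=
    pow_le_of_le_one hq0 hq1.le (Nat.succ_ne_zero _)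
  have h3 := hYr P (j + 1)
  have h4 : 0 ≤ Y P * ‖y‖ := hY P y ▸ norm_nonneg _
  calc _ = (opNorm d / r) ^ (j + 1) * (Y (hasseDeriv (j + 1) P) * r ^ (j + 1) * ‖y‖) := by
        rw [h1]; ring
    _ ≤ (opNorm d / r) ^ (j + 1) * (Y P * ‖y‖) := by gcongr
    _ ≤ _ := by gcongr

include hd in
/-- If `z` is a root of `P`, the formal adjoint of `P(d - T(x))` does not reach a neighbourhood
of `-1` in `Ω ⊗ ℋ(π(z))`. -/
theorem one_le_norm_adjoint_add_one (hz : opNorm d < (projPoint k z).radius) {P : Polynomial Ω}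
    (hPz : aeval z P = 0) (n : ℕ) (y : TensorAlg k Ω (projPoint k z).ResidueField) :
    1 ≤ ‖(∑ j ∈ Finset.range (n + 1), (-tensorDeriv (projPoint k z) d) ^ j *
      tensorMulEval Ω (projPoint k z) (hasseDeriv j P)) y + 1‖ := by
  by_contra! hU
  have hr0 : 0 < (projPoint k z).radius := (opNorm_nonneg d).trans_lt hz
  obtain ⟨r, hrx⟩ : ∃ r : ℝ≥0, (r : ℝ) = (projPoint k z).radius :=
    ⟨⟨(projPoint k z).radius, hr0.le⟩, rfl⟩
  have hr : 0 < r := NNReal.coe_pos.1 (hrx ▸ hr0)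
  have h1 : ‖(1 : TensorAlg k Ω (projPoint k z).ResidueField)‖ = 1 := by
    rw [← norm_tensorMap_gaussPoint (hr := hr) hrx, map_one, norm_one]
  have hdiff := norm_adjoint_sub_le hd (x := projPoint k z) hz (norm_tensorEval_mul hr hrx)
    (fun p j => hrx ▸ gaussPoint_seminorm_hasseDeriv_le p j) P n y
  have hfinal := norm_add_lt_one_of_approx h1 hU (div_nonneg (opNorm_nonneg d) hr0.le)
    ((div_lt_one hr0).2 hz) hdiff
  -- Evaluation at z itself, rather than at the Gauss point, kills P(T(x)); being contractive, it
  -- sends P(T(x)) y + 1, of norm < 1, to 1, which is absurd.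
  have hy0 := projPoint_liesOver (k := k) z
  have h4 := hy0.norm_tensorMap_le (tensorEval (projPoint k z) Ω P * y + 1)
  have h5 : (projPoint Ω z).evalHom P = 0 := by
    rw [← norm_eq_zero, BerkovichLine.norm_evalHom, projPoint_seminorm, hPz, map_zero]
  rw [map_add, map_mul, map_one, hy0.tensorMap_tensorEval, h5, zero_mul, zero_add, norm_one] at h4
  exact absurd (h4.trans_lt hfinal) (lt_irrefl _)

end Root

/-! ### Projections of roots belong to the spectrum. -/

section Superset

variable {k : Type*} [NormedField k] {Ω : Type*} [NormedField Ω] [NormedAlgebra k Ω]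
  {d : Derivation k Ω Ω} {E : Type*} [NormedRing E] [NormedAlgebra k E]

/-- The element `f ⊗ 1 - 1 ⊗ T(x)` of `E ⊗ ℋ(x)`. -/
def tensorSubCoord (x : BerkovichLine k) (f : E) :
    TensorAlg k E x.ResidueField :=
  TensorAlg.tmul f 1 - TensorAlg.tmul 1 x.coord

theorem mem_spectrum_iff (x : BerkovichLine k) (f : E) : x ∈ spectrum k f ↔
      ¬ IsUnit (tensorSubCoord x f : CompletedTensor k E x.ResidueField) := Iff.rfl

theorem map_tensorSubCoord_mul
    (x : BerkovichLine k) (f φ : E) (h : x.ResidueField) (T : E →ₗ[k] Ω) :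
    TensorAlg.map T (tensorSubCoord x f * TensorAlg.tmul φ h) =
      TensorAlg.tmul (T (f * φ)) h - TensorAlg.tmul (T φ) (x.coord * h) := by
  rw [tensorSubCoord, sub_mul, TensorAlg.tmul_mul_tmul, TensorAlg.tmul_mul_tmul, one_mul, one_mul,
    map_sub, TensorAlg.map_tmul, TensorAlg.map_tmul]

/-- Linear forms `T₀, …, Tₙ` on `E`, such that left multiplication by `f` acts on them through the
companion matrix of `P`, where `n + 1` is the degree of `P`. -/
structure CompanionForms (d : Derivation k Ω Ω) (f : E) (P : Polynomial Ω) (n : ℕ) where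
  /-- the linear forms -/
  form : ℕ → E →ₗ[k] Ω
  form_one : ∀ j ≤ n, form j 1 = if j = 0 then 1 else 0
  form_mul : ∀ j ≤ n, ∀ φ, form j (f * φ) =
    d (form j φ) + (if j = 0 then 0 else form (j - 1) φ) - P.coeff j * form n φ

variable {f : E} {P : Polynomial Ω} {n : ℕ} (T : CompanionForms d f P n) (x : BerkovichLine k)

theorem TensorAlg.tmul_sub_tmul (a b : Ω) (h : x.ResidueField) : (TensorAlg.tmul a h -
    TensorAlg.tmul b h : TensorAlg k Ω x.ResidueField) = TensorAlg.tmul (a - b) h := by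
  rw [sub_eq_iff_eq_add, ← TensorAlg.add_tmul, sub_add_cancel]

include T in
-- Base change to ℋ(x) of the companion relations, put in the shape required by
-- `sum_pow_smul_of_recurrence` with δ = T(x) - d. Everything is additive in b, so pure tensors
-- suffice.
theorem CompanionForms.map_recurrence (b : TensorAlg k E x.ResidueField) (j : ℕ) (hj : j ≤ n) :
    TensorAlg.map (T.form j) (tensorSubCoord x f * b) =
      (if j = 0 then 0 else TensorAlg.map (T.form (j - 1)) b) -
        (tensorMulEval Ω x X - tensorDeriv x d) • TensorAlg.map (T.form j) b -
        tensorMulEval Ω x (C (P.coeff j)) • TensorAlg.map (T.form n) b := by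
  induction b using TensorAlg.induction with
  | h0 => simp
  | ha v w hv hw =>
    rw [mul_add, map_add, hv, hw]
    rw [sub_add_sub_comm, sub_add_sub_comm, ← smul_add, ← smul_add, ← map_add, ← map_add]
    split_ifs with h
    · rw [add_zero]
    · rw [← map_add]
  | ht φ h =>
    rw [map_tensorSubCoord_mul]
    simp only [TensorAlg.map_tmul, Module.End.smul_def, LinearMap.sub_apply, tensorDeriv_tmul,
      tensorMulEval_apply, tensorEval_X, tensorEval_C, TensorAlg.tmul_mul_tmul, one_mul]
    rw [T.form_mul j hj, ← TensorAlg.tmul_sub_tmul]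
    split_ifs with h0
    · rw [add_zero, zero_sub, neg_sub, sub_right_comm]
    · rw [TensorAlg.add_tmul, ← sub_add, sub_right_comm, add_comm (TensorAlg.tmul (d _) h),
        add_sub_right_comm]

/-- The combination G = ∑ δʲ Tⱼ sends 1 to 1 and sends a · b to -U(Tₙ b), where a = f ⊗ 1 - 1 ⊗ T(x)
and U is the adjoint operator. If a · b were close to 1, then U(Tₙ b) would be close to -1, which
`one_le_norm_adjoint_add_one` excludes. -/
theorem CompanionForms.projPoint_mem_spectrum [IsAlgClosed k] [IsUltrametricDist Ω]
    [CompleteSpace Ω] (hd : IsBoundedOp d) (hT : ∀ j, IsBoundedOp (T.form j)) (hP : P.Monic)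
    (hn : P.natDegree = n + 1)
    {z : AlgebraicClosure Ω} (hPz : aeval z P = 0) (hz : opNorm d < (projPoint k z).radius) :
    projPoint k z ∈ spectrum k f := by
  rw [mem_spectrum_iff]
  intro hunit
  set x := projPoint k z
  set a := tensorSubCoord x f with ha
  set δ := tensorMulEval Ω x X - tensorDeriv x d with hδ
  have hbound (j : ℕ) : ∃ C : ℝ, 0 ≤ C ∧
      ∀ v, ‖δ ^ j • TensorAlg.map (H := x.ResidueField) (T.form j) v‖ ≤ C * ‖v‖ := by
    obtain ⟨C, hC, h⟩ := exists_norm_sub_tensorDeriv_pow_le x hd j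
    refine ⟨C * opNorm (T.form j), mul_nonneg hC (opNorm_nonneg _), fun v => (h _).trans ?_⟩
    rw [mul_assoc]
    exact mul_le_mul_of_nonneg_left (TensorAlg.norm_map_apply_le (T.form j)
      (opNorm_nonneg _) (hT j).le_opNorm v) hC
  choose K hK0 hK using hbound
  let G (v : TensorAlg k E x.ResidueField) :=
    ∑ j ∈ Finset.range (n + 1), δ ^ j • TensorAlg.map (T.form j) v
  set K' := ∑ j ∈ Finset.range (n + 1), K j with hK'
  have hK'0 : 0 ≤ K' := Finset.sum_nonneg fun j _ => hK0 j
  have hG (v) : ‖G v‖ ≤ K' * ‖v‖ := by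
    rw [hK', Finset.sum_mul]
    exact (norm_sum_le _ _).trans (Finset.sum_le_sum fun j _ => hK j v)
  have hGsub (v w) : G (v - w) = G v - G w := by
    simp only [G, map_sub, smul_sub, Finset.sum_sub_distrib]
  have hG1 : G 1 = 1 := by
    have h1 (j : ℕ) (hj : j < n + 1) :
        TensorAlg.map (H := x.ResidueField) (T.form j) 1 = if j = 0 then 1 else 0 := by
      rw [TensorAlg.one_def, TensorAlg.map_tmul, T.form_one j (by omega)]
      split_ifs
      · rfl
      · exact TensorProduct.zero_tmul _ _
    simp only [G]
    rw [Finset.sum_eq_single 0]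
    · rw [h1 0 (by omega), if_pos rfl, pow_zero, one_smul]
    · intro j hj hj0
      rw [h1 j (Finset.mem_range.1 hj), if_neg hj0, smul_zero]
    · simp
  -- The precision 1/(K' + 1) makes ‖G (a * b - 1)‖ < 1, as K' bounds G.
  obtain ⟨b, hb⟩ := exists_approx_right_inverse hunit (show 0 < 1 / (K' + 1) by positivity)
  have hrec := sum_pow_smul_of_recurrence δ (fun j => TensorAlg.map (T.form j) b)
    (fun j => tensorMulEval Ω x (C (P.coeff j)) • TensorAlg.map (T.form n) b)
    (fun j => TensorAlg.map (T.form j) (a * b)) n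
    (by rw [← zero_sub]; exact T.map_recurrence x b 0 (Nat.zero_le n))
    (fun j hj => T.map_recurrence x b (j + 1) hj)
  -- Telescoping gives -∑ δⁱ aᵢ applied to the last form, the leading coefficient 1 of P supplying
  -- the term δⁿ⁺¹; Taylor's formula rewrites the sum with divided derivatives.
  have hGa : G (a * b) = -((∑ j ∈ Finset.range (n + 1 + 1), (-tensorDeriv x d) ^ j *
      tensorMulEval Ω x (hasseDeriv j P)) (TensorAlg.map (T.form n) b)) := by
    rw [← sum_sub_pow_mul_eq_sum_hasseDeriv (tensorMulEval Ω x) (tensorDeriv x d)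
      (commute_tensorDeriv x d) P _ (by omega), Finset.sum_range_succ]
    have hlead : P.coeff (n + 1) = 1 := hn ▸ hP
    simp only [G]
    rw [hrec, hlead, map_one, map_one, mul_one, LinearMap.add_apply, LinearMap.sum_apply]
    simp only [Module.End.smul_def, Module.End.mul_apply]
    rw [neg_add', sub_eq_add_neg, sub_eq_add_neg, add_comm]
  have h1 := one_le_norm_adjoint_add_one hd hz hPz (n + 1) (TensorAlg.map (T.form n) b)
  have h2 : ‖G (a * b - 1)‖ < 1 := by
    refine (hG _).trans_lt ?_
    change ‖a * b - 1‖ < _ at hb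
    rw [lt_div_iff₀ (by positivity)] at hb
    nlinarith [norm_nonneg (a * b - 1)]
  rw [hGsub, hG1, hGa, ← norm_neg] at h2
  refine absurd h2 (not_lt.2 ?_)
  rwa [neg_sub_left, neg_neg, add_comm]

end Superset

/-! ### The linear forms on L_k(M) attached to a cyclic basis. -/

section EvalForm

variable {k : Type*} [NormedField k] {Ω : Type*} [NormedField Ω] [NormedAlgebra k Ω]
  {d : Derivation k Ω Ω} {M : Type*} [NormedAddCommGroup M]
  [NormedSpace Ω M] [NormedSpace k M] [IsScalarTower k Ω M] {D : Connection d M}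
  {P : Polynomial Ω}

/-- The linear map `φ ↦ f (φ m)` on `L_k(M)`. -/
def evalForm (f : M →ₗ[Ω] Ω) (m : M) : BoundedEnd k M →ₗ[k] Ω where
  toFun φ := f (φ.1 m)
  map_add' φ ψ := by simp
  map_smul' a φ := by
    change f (a • φ.1 m) = a • f (φ.1 m)
    exact (f.restrictScalars k).map_smul a _

theorem isBoundedOp_evalForm {f : M →ₗ[Ω] Ω} (hf : IsBoundedOp f) (m : M) :
    IsBoundedOp (evalForm (k := k) f m) := by
  refine ⟨opNorm f * ‖m‖, fun φ => (hf.le_opNorm _).trans ?_⟩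
  rw [mul_assoc, mul_comm ‖m‖]
  exact mul_le_mul_of_nonneg_left (IsBoundedOp.le_opNorm φ.2 m) (opNorm_nonneg f)

/-- The linear forms on `L_k(M)` defined by a cyclic basis. -/
def CyclicFrame.companionForms (F : CyclicFrame D P) (hD : D.toLinearMap ∈ BoundedEnd k M) {n : ℕ}
    (hn : P.natDegree = n + 1) :
    CompanionForms d (⟨D.toLinearMap, hD⟩ : BoundedEnd k M) P n where
  form j := evalForm (F.coord j) (F.s 0)
  form_one j hj := by
    refine (F.coord_s 0 (by omega) j (by omega)).trans ?_
    simp only [eq_comm]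
  form_mul j hj φ := by
    change F.coord j (D.toLinearMap (φ.1 (F.s 0))) = _
    rcases j with _ | j
    · rw [F.coord_apply_zero hn, if_pos rfl, add_zero]
      rfl
    · rw [F.coord_apply_succ hn (by omega), if_neg (Nat.succ_ne_zero j)]
      rfl

theorem CyclicFrame.projPoint_mem_spectrum [IsAlgClosed k] [IsUltrametricDist Ω] [CompleteSpace Ω]
    (F : CyclicFrame D P) (hD : D.toLinearMap ∈ BoundedEnd k M)
    (hd : IsBoundedOp d) (hF : ∀ j, IsBoundedOp (F.coord j)) (hP : P.Monic)
    {z : AlgebraicClosure Ω} (hPz : aeval z P = 0) (hz : opNorm d < (projPoint k z).radius) :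
    projPoint k z ∈ spectrum k (⟨D.toLinearMap, hD⟩ : BoundedEnd k M) := by
  obtain ⟨n, hn⟩ : ∃ n, P.natDegree = n + 1 := by
    refine ⟨P.natDegree - 1, (Nat.sub_add_cancel (Nat.pos_of_ne_zero fun h => ?_)).symm⟩
    rw [hP.natDegree_eq_zero.1 h, map_one] at hPz
    exact one_ne_zero hPz
  exact (F.companionForms hD hn).projPoint_mem_spectrum hd
    (fun j => isBoundedOp_evalForm (hF j) _) hP hn hPz hz

end EvalForm

/-! ### Minimal polynomials over a complete field -/

section Minpoly

variable {Ω : Type*} [NormedField Ω] [IsUltrametricDist Ω] [CompleteSpace Ω]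

/-- The absolute value of z is the spectral norm, the supremum of the ‖aᵢ‖^(1/(m - i)), with aᵢ the
coefficients and m the degree. -/
theorem norm_minpoly_coeff_le (z : AlgebraicClosure Ω) {i : ℕ} (hi : i ≤ (minpoly Ω z).natDegree) :
    ‖(minpoly Ω z).coeff i‖ ≤ algClosureAbs Ω z ^ ((minpoly Ω z).natDegree - i) := by
  rcases hi.eq_or_lt with rfl | hi
  · rw [(minpoly.monic (Algebra.IsIntegral.isIntegral z)).coeff_natDegree, norm_one, Nat.sub_self,
      pow_zero]
  · have h1 : ‖(minpoly Ω z).coeff i‖ ^ (1 / ((minpoly Ω z).natDegree - (i : ℝ))) ≤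
        algClosureAbs Ω z := by
      rw [← spectralValueTerms_of_lt_natDegree _ hi]
      exact le_ciSup (spectralValueTerms_bddAbove _) i
    have h2 : (minpoly Ω z).natDegree - (i : ℝ) = (((minpoly Ω z).natDegree - i : ℕ) : ℝ) := by
      rw [Nat.cast_sub hi.le]
    rw [h2, one_div] at h1
    have h3 := pow_le_pow_left₀ (by positivity) h1 ((minpoly Ω z).natDegree - i)
    rwa [Real.rpow_inv_natCast_pow (norm_nonneg _) (by omega)] at h3

/-- Conjugates share their minimal polynomial, hence their absolute value, and the constant term is
their product up to sign. -/
theorem norm_minpoly_coeff_zero (z : AlgebraicClosure Ω) :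
    ‖(minpoly Ω z).coeff 0‖ = algClosureAbs Ω z ^ (minpoly Ω z).natDegree := by
  have hint : IsIntegral Ω z := Algebra.IsIntegral.isIntegral z
  set q := (minpoly Ω z).map (algebraMap Ω (AlgebraicClosure Ω)) with hq
  have hspl : q.Splits := IsAlgClosed.splits q
  have hroots : ∀ a ∈ q.roots, algClosureAbs Ω a = algClosureAbs Ω z := by
    intro a ha
    have h1 : aeval a (minpoly Ω z) = 0 := by
      rw [aeval_def, ← eval_map]
      exact (mem_roots'.1 ha).2
    have h2 : minpoly Ω z = minpoly Ω a :=
      minpoly.eq_of_irreducible_of_monic (minpoly.irreducible hint) h1 (minpoly.monic hint)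
    change spectralNorm Ω (AlgebraicClosure Ω) a = spectralNorm Ω (AlgebraicClosure Ω) z
    rw [spectralNorm, spectralNorm, h2]
  rw [← algClosureAbs_algebraMap, ← coeff_map, ← hq,
    hspl.coeff_zero_eq_prod_roots_of_monic ((minpoly.monic hint).map _), map_mul, map_pow,
    AbsoluteValue.map_neg, map_one, one_pow, one_mul, map_multiset_prod,
    Multiset.map_congr rfl hroots, Multiset.map_const', Multiset.prod_replicate,
    ← hspl.natDegree_eq_card_roots, natDegree_map]

omit [IsUltrametricDist Ω] [CompleteSpace Ω] in
theorem taylor_minpoly (z : AlgebraicClosure Ω) (c : Ω) :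
    taylor c (minpoly Ω z) = minpoly Ω (z - algebraMap Ω (AlgebraicClosure Ω) c) := by
  rw [minpoly.sub_algebraMap, taylor_apply]

end Minpoly

/-! ### Polynomials without roots above `x` -/

section Good

/-- Factor y + e = (1 + e y⁻¹) y. In the application y is the dominant term of a polynomial and e
the rest. -/
theorem exists_unit_add_of_norm_lt {A : Type*} [NormedRing A] [CompleteSpace A]
    [IsUltrametricDist A] (h1 : ‖(1 : A)‖ ≤ 1) (y : Aˣ) {e : A} {G : ℝ} (hG : 0 < G)
    (hy : ‖(↑y⁻¹ : A)‖ ≤ G⁻¹) (he : ‖e‖ < G) :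
    ∃ w : Aˣ, (w : A) = y + e ∧ ‖(↑w⁻¹ : A)‖ ≤ G⁻¹ := by
  have hs : ‖e * ↑y⁻¹‖ < 1 := by
    refine (norm_mul_le _ _).trans_lt ?_
    calc ‖e‖ * ‖(↑y⁻¹ : A)‖ ≤ ‖e‖ * G⁻¹ := by gcongr
      _ < G * G⁻¹ := by gcongr
      _ = 1 := mul_inv_cancel₀ hG.ne'
  obtain ⟨v, hv, hv'⟩ := exists_unit_of_norm_lt_one h1 hs
  refine ⟨v * y, ?_, ?_⟩
  · rw [Units.val_mul, hv, add_mul, one_mul, mul_assoc, Units.inv_mul, mul_one]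
  · rw [mul_inv_rev, Units.val_mul]
    exact (norm_mul_le _ _).trans ((mul_le_mul hy hv' (norm_nonneg _) (by positivity)).trans_eq
      (mul_one _))

variable {k : Type*} [NormedField k] {Ω : Type*} [NormedField Ω] [NormedAlgebra k Ω]
  {x : BerkovichLine k} {A : Type*} [NormedRing A] (Ψ : TensorAlg k Ω x.ResidueField →+* A)

/-- `Q(T(x))` is invertible in `A`, with all divided derivatives of `Q` small relatively to `Q`. -/
def DominatesDerivatives (ρ : ℝ) (Q : Polynomial Ω) : Prop :=
  ∃ w : Aˣ, (w : A) = Ψ (tensorEval x Ω Q) ∧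
    ∀ j, ‖Ψ (tensorEval x Ω (hasseDeriv j Q)) * ↑w⁻¹‖ * ρ ^ j ≤ 1

variable {Ψ} {ρ : ℝ}

theorem tensorEval_commute (p q : Polynomial Ω) :
    Commute (Ψ (tensorEval x Ω p)) (Ψ (tensorEval x Ω q)) := by
  rw [commute_iff_eq, ← map_mul, ← map_mul, mul_comm p q, map_mul, map_mul]

theorem dominatesDerivatives_C (h1 : ‖(1 : A)‖ ≤ 1) {a : Ω} (ha : a ≠ 0) :
    DominatesDerivatives Ψ ρ (C a) := by
  have hu : IsUnit (C a) := isUnit_C.2 ha.isUnit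
  obtain ⟨w, hw⟩ := (hu.map (tensorEval x Ω)).map Ψ
  refine ⟨w, hw, fun j => ?_⟩
  rcases Nat.eq_zero_or_pos j with rfl | hj
  · rw [hasseDeriv_zero', ← hw, Units.mul_inv, pow_zero, mul_one]
    exact h1
  · rw [hasseDeriv_C _ _ hj]
    simp

/-- By the Leibniz rule for divided derivatives, (QR)^[j]/(QR) is the sum of the products
(Q^[i]/Q)(R^[l]/R) with i + l = j. The algebra A is not commutative, but all values at T(x) and
their inverses commute. -/
theorem DominatesDerivatives.mul [IsUltrametricDist A] (hρ : 0 ≤ ρ) {Q R : Polynomial Ω}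
    (hQ : DominatesDerivatives Ψ ρ Q) (hR : DominatesDerivatives Ψ ρ R) :
    DominatesDerivatives Ψ ρ (Q * R) := by
  obtain ⟨u, hu, hu'⟩ := hQ
  obtain ⟨v, hv, hv'⟩ := hR
  refine ⟨u * v, by rw [Units.val_mul, hu, hv, map_mul, map_mul], fun j => ?_⟩
  rcases hρ.eq_or_lt with rfl | hρ
  · rcases Nat.eq_zero_or_pos j with rfl | hj
    · have h0 := hu' 0
      rw [pow_zero, mul_one, hasseDeriv_zero', ← hu, Units.mul_inv] at h0
      rw [pow_zero, mul_one, hasseDeriv_zero', map_mul, map_mul, ← hu, ← hv, ← Units.val_mul,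
        Units.mul_inv]
      exact h0
    · rw [zero_pow hj.ne', mul_zero]
      exact zero_le_one
  have hpow : (0 : ℝ) < ρ ^ j := pow_pos hρ j
  rw [← le_div_iff₀ hpow, hasseDeriv_mul, map_sum, map_sum, Finset.sum_mul]
  refine IsUltrametricDist.norm_sum_le_of_forall_le_of_nonneg (by positivity) fun ij hij => ?_
  rw [le_div_iff₀ hpow]
  obtain ⟨i, l⟩ := ij
  have hj : i + l = j := Finset.HasAntidiagonal.mem_antidiagonal.1 hij
  have e : Ψ (tensorEval x Ω (hasseDeriv i Q * hasseDeriv l R)) * ↑(u * v)⁻¹ =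
      (Ψ (tensorEval x Ω (hasseDeriv i Q)) * ↑u⁻¹) *
        (Ψ (tensorEval x Ω (hasseDeriv l R)) * ↑v⁻¹) := by
    have hcomm : Commute (↑u⁻¹ : A) (Ψ (tensorEval x Ω (hasseDeriv l R)) * ↑v⁻¹) := by
      refine Commute.units_inv_left ?_
      rw [hu]
      refine (tensorEval_commute _ _).mul_right (Commute.units_inv_right ?_)
      rw [hv]
      exact tensorEval_commute _ _
    rw [mul_assoc, hcomm.eq, mul_inv_rev, Units.val_mul, map_mul, map_mul]
    simp only [mul_assoc]
  simp only [e]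
  calc _ ≤ (‖Ψ (tensorEval x Ω (hasseDeriv i Q)) * ↑u⁻¹‖ * ρ ^ i) *
        (‖Ψ (tensorEval x Ω (hasseDeriv l R)) * ↑v⁻¹‖ * ρ ^ l) := by
        rw [← hj, pow_add, mul_mul_mul_comm]
        exact mul_le_mul_of_nonneg_right (norm_mul_le _ _) (by positivity)
    _ ≤ 1 := mul_le_one₀ (hu' i) (by positivity) (hv' l)

variable [IsAlgClosed k] [IsUltrametricDist Ω] [CompleteSpace Ω] [CompleteSpace A]
  [IsUltrametricDist A]

theorem exists_seminorm_X_sub_C_ne {y : BerkovichLine k} (h : x ≠ y) :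
    ∃ c : k, x.seminorm (X - C c) ≠ y.seminorm (X - C c) := by
  by_contra! hc
  refine h (BerkovichLine.ext_seminorm fun f => valuation_eq_of_X_sub_C _ _ (fun a => ?_) hc f)
  rw [x.seminorm_C, y.seminorm_C]

/-- Let τ = |T(x) - c| and σ = |z - c| be distinct, and g their maximum. In the expansion around c
the coefficient of index i is at most σ^(m - i), with equality for i = 0 and value 1 for i = m.
Hence exactly one extreme term reaches size gᵐ, the value is invertible with inverse of norm at most
g⁻ᵐ, and the j-th divided derivative has norm at most g^(m - j); finally g ≥ σ ≥ ρ. -/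
theorem dominatesDerivatives_minpoly (h1 : ‖(1 : A)‖ ≤ 1) (hΨ : ∀ v, ‖Ψ v‖ ≤ ‖v‖) (hρ : 0 < ρ)
    {z : AlgebraicClosure Ω} (hx : x ≠ projPoint k z) (hz : ρ ≤ (projPoint k z).radius) :
    DominatesDerivatives Ψ ρ (minpoly Ω z) := by
  obtain ⟨c, hc⟩ := exists_seminorm_X_sub_C_ne hx
  set q := minpoly Ω z with hq
  set m := q.natDegree with hm
  have hm0 : 0 < m := minpoly.natDegree_pos (Algebra.IsIntegral.isIntegral z)
  set c' := algebraMap k Ω c with hc'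
  obtain ⟨τ, hτ⟩ : ∃ τ : ℝ, τ = x.seminorm (X - C c) := ⟨_, rfl⟩
  obtain ⟨σ, hσ⟩ : ∃ σ : ℝ, σ = (projPoint k z).seminorm (X - C c) := ⟨_, rfl⟩
  have hτσ : τ ≠ σ := fun h => hc (NNReal.eq (by rw [← hτ, ← hσ, h]))
  have hτ0 : 0 ≤ τ := hτ ▸ NNReal.coe_nonneg _
  have hρσ : ρ ≤ σ := hσ ▸ hz.trans (BerkovichLine.radius_le _ c)
  have hσ0 : 0 < σ := hρ.trans_le hρσ
  have htay : taylor c' q = minpoly Ω (z - algebraMap Ω (AlgebraicClosure Ω) c') :=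
    taylor_minpoly z c'
  have hσ' : σ = algClosureAbs Ω (z - algebraMap Ω (AlgebraicClosure Ω) c') := by
    rw [hσ, projPoint_seminorm_X_sub_C]
  have hdeg : (minpoly Ω (z - algebraMap Ω (AlgebraicClosure Ω) c')).natDegree = m := by
    rw [← htay, natDegree_taylor]
  have hb : ∀ i ≤ m, ‖(taylor c' q).coeff i‖ ≤ σ ^ (m - i) := fun i hi => by
    rw [htay, hσ', ← hdeg]
    exact norm_minpoly_coeff_le _ (hdeg.symm ▸ hi)
  have hb' : ∀ i, m < i → (taylor c' q).coeff i = 0 := fun i hi =>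
    coeff_eq_zero_of_natDegree_lt (by rwa [natDegree_taylor])
  have hb0 : ‖(taylor c' q).coeff 0‖ = σ ^ m := by
    rw [htay, hσ', ← hdeg]
    exact norm_minpoly_coeff_zero _
  have hbm : (taylor c' q).coeff m = 1 := by
    rw [hm, coeff_taylor_natDegree]
    exact minpoly.monic (Algebra.IsIntegral.isIntegral z)
  have hle (p : Polynomial Ω) {B : ℝ} (hB : 0 ≤ B)
      (h : ∀ i, ‖(taylor c' p).coeff i‖ * τ ^ i ≤ B) : ‖Ψ (tensorEval x Ω p)‖ ≤ B :=
    (hΨ _).trans (norm_tensorEval_le x c p hB fun i => hτ ▸ h i)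
  set g := max σ τ with hg
  have hσg : σ ≤ g := le_max_left _ _
  have hτg : τ ≤ g := le_max_right _ _
  have hg0 : 0 < g := hσ0.trans_le hσg
  suffices hw : ∃ w : Aˣ, (w : A) = Ψ (tensorEval x Ω q) ∧ ‖(↑w⁻¹ : A)‖ ≤ (g ^ m)⁻¹ by
    obtain ⟨w, hw, hw'⟩ := hw
    refine ⟨w, hw, fun j => ?_⟩
    rcases lt_or_ge m j with hj | hj
    · rw [hasseDeriv_eq_zero_of_lt_natDegree _ _ hj]
      simp
    · have h2 : ‖Ψ (tensorEval x Ω (hasseDeriv j q))‖ ≤ g ^ (m - j) := by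
        refine hle _ (by positivity) fun i => ?_
        have e : (taylor c' (hasseDeriv j q)).coeff i =
            ((i + j).choose i : Ω) * (taylor c' q).coeff (i + j) := by
          have := LinearMap.congr_fun (hasseDeriv_comp (R := Ω) i j) q
          rw [LinearMap.comp_apply] at this
          rw [taylor_coeff, taylor_coeff, this]
          simp
        rw [e, norm_mul]
        rcases lt_or_ge m (i + j) with hij | hij
        · rw [hb' _ hij]
          simp only [norm_zero, mul_zero, zero_mul]
          positivity
        · calc _ ≤ (1 * σ ^ (m - (i + j))) * τ ^ i := by
                gcongr
                · exact IsUltrametricDist.norm_natCast_le_one Ω _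
                · exact hb _ hij
            _ ≤ (1 * g ^ (m - (i + j))) * g ^ i := by gcongr
            _ = g ^ (m - j) := by rw [one_mul, ← pow_add]; congr 1; omega
      calc _ ≤ (g ^ (m - j) * (g ^ m)⁻¹) * ρ ^ j := by
            gcongr
            exact (norm_mul_le _ _).trans (mul_le_mul h2 hw' (norm_nonneg _) (by positivity))
        _ ≤ (g ^ (m - j) * (g ^ m)⁻¹) * g ^ j := by
            gcongr
            exact hρσ.trans hσg
        _ = 1 := by
            rw [mul_right_comm, ← pow_add, Nat.sub_add_cancel hj, mul_inv_cancel₀ (by positivity)]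
  rcases lt_or_gt_of_ne hτσ with h | h
  · have hgσ : g = σ := max_eq_left h.le
    rw [hgσ]
    set b := (taylor c' q).coeff 0 with hbdef
    have hbne : b ≠ 0 := norm_pos_iff.1 (by rw [hb0]; positivity)
    let y : Aˣ := ⟨Ψ (tensorEval x Ω (C b)), Ψ (tensorEval x Ω (C b⁻¹)),
      by rw [← map_mul, ← map_mul, ← C_mul, mul_inv_cancel₀ hbne, C_1, map_one, map_one],
      by rw [← map_mul, ← map_mul, ← C_mul, inv_mul_cancel₀ hbne, C_1, map_one, map_one]⟩
    have hy : ‖(↑y⁻¹ : A)‖ ≤ (σ ^ m)⁻¹ := by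
      refine hle _ (by positivity) fun i => ?_
      rw [taylor_C]
      rcases i with _ | i
      · rw [coeff_C_zero, norm_inv, hb0, pow_zero, mul_one]
      · rw [coeff_C_succ, norm_zero, zero_mul]
        positivity
    have he : ‖Ψ (tensorEval x Ω (q - C b))‖ < σ ^ m := by
      refine (hle (q - C b) (B := σ ^ (m - 1) * τ) (by positivity) fun i => ?_).trans_lt ?_
      · rw [map_sub, taylor_C, coeff_sub]
        rcases i with _ | i
        · rw [coeff_C_zero, ← hbdef, sub_self, norm_zero, zero_mul]
          positivity
        · rw [coeff_C_succ, sub_zero]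
          rcases lt_or_ge m (i + 1) with hi | hi
          · rw [hb' _ hi, norm_zero, zero_mul]
            positivity
          · calc _ ≤ σ ^ (m - (i + 1)) * τ ^ (i + 1) := by
                  gcongr
                  exact hb _ hi
              _ = σ ^ (m - (i + 1)) * τ ^ i * τ := by ring
              _ ≤ σ ^ (m - (i + 1)) * σ ^ i * τ := by gcongr
              _ = σ ^ (m - 1) * τ := by rw [← pow_add]; congr 2; omega
      · calc σ ^ (m - 1) * τ < σ ^ (m - 1) * σ := by gcongr
          _ = σ ^ m := by rw [← pow_succ, Nat.sub_add_cancel hm0]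
    obtain ⟨w, hw, hw'⟩ := exists_unit_add_of_norm_lt h1 y (by positivity) hy he
    refine ⟨w, hw.trans ?_, hw'⟩
    change Ψ (tensorEval x Ω (C b)) + _ = _
    rw [← map_add, ← map_add, add_sub_cancel]
  -- Case σ < τ: the leading term (T(x) - c)ᵐ dominates, every other term being at most σ τ^(m - 1).
  · have hgτ : g = τ := max_eq_right h.le
    have hτpos : 0 < τ := hσ0.trans h
    rw [hgτ]
    set t := x.evalHom (X - C c) with ht
    have htn : ‖t‖ = τ := by rw [ht, BerkovichLine.norm_evalHom, hτ]
    have ht0 : t ≠ 0 := norm_pos_iff.1 (htn ▸ hτpos)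
    have hXm : tensorEval x Ω ((X - C c') ^ m) = TensorAlg.tmul 1 (t ^ m) := by
      have : ((X - C c') ^ m : Polynomial Ω) = ((X - C c) ^ m).map (algebraMap k Ω) := by simp [hc']
      rw [this, tensorEval_map, map_pow]
    let y : Aˣ := ⟨Ψ (TensorAlg.tmul 1 (t ^ m)), Ψ (TensorAlg.tmul 1 (t ^ m)⁻¹),
      by rw [← map_mul, TensorAlg.tmul_mul_tmul, mul_one, mul_inv_cancel₀ (pow_ne_zero _ ht0),
        ← TensorAlg.one_def, map_one],
      by rw [← map_mul, TensorAlg.tmul_mul_tmul, mul_one, inv_mul_cancel₀ (pow_ne_zero _ ht0),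
        ← TensorAlg.one_def, map_one]⟩
    have hy : ‖(↑y⁻¹ : A)‖ ≤ (τ ^ m)⁻¹ := by
      refine (hΨ _).trans ((TensorAlg.norm_tmul_le _ _).trans ?_)
      rw [norm_one, one_mul, norm_inv, norm_pow, htn]
    have he : ‖Ψ (tensorEval x Ω (q - (X - C c') ^ m))‖ < τ ^ m := by
      refine (hle _ (B := σ * τ ^ (m - 1)) (by positivity) fun i => ?_).trans_lt ?_
      · have e : taylor c' ((X - C c') ^ m) = X ^ m := by
          rw [taylor_pow, map_sub, taylor_X, taylor_C, add_sub_cancel_right]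
        rw [map_sub, e, coeff_sub, coeff_X_pow]
        rcases lt_trichotomy i m with hi | rfl | hi
        · rw [if_neg hi.ne, sub_zero]
          calc _ ≤ σ ^ (m - i) * τ ^ i := by
                gcongr
                exact hb _ hi.le
            _ = σ * σ ^ (m - 1 - i) * τ ^ i := by
                rw [← pow_succ']; congr 2; omega
            _ ≤ σ * τ ^ (m - 1 - i) * τ ^ i := by gcongr
            _ = σ * τ ^ (m - 1) := by rw [mul_assoc, ← pow_add]; congr 2; omega
        · rw [if_pos rfl, hbm, sub_self, norm_zero, zero_mul]
          positivity
        · rw [if_neg hi.ne', hb' _ hi, sub_zero, norm_zero, zero_mul]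
          positivity
      · calc σ * τ ^ (m - 1) < τ * τ ^ (m - 1) := by gcongr
          _ = τ ^ m := by rw [← pow_succ', Nat.sub_add_cancel hm0]
    obtain ⟨w, hw, hw'⟩ := exists_unit_add_of_norm_lt h1 y (by positivity) hy he
    refine ⟨w, hw.trans ?_, hw'⟩
    change Ψ (TensorAlg.tmul 1 (t ^ m)) + _ = _
    rw [← hXm, ← map_add, ← map_add, add_sub_cancel]

/-- The property is multiplicative, and each irreducible factor is a constant times the minimal
polynomial of one of its roots, which is also a root of P. -/
theorem dominatesDerivatives_of_roots (h1 : ‖(1 : A)‖ ≤ 1) (hΨ : ∀ v, ‖Ψ v‖ ≤ ‖v‖) (hρ : 0 < ρ)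
    (P : Polynomial Ω) (hP : P ≠ 0) (hx : ∀ z : AlgebraicClosure Ω, aeval z P = 0 →
      x ≠ projPoint k z ∧ ρ ≤ (projPoint k z).radius) :
    DominatesDerivatives Ψ ρ P := by
  induction P using UniqueFactorizationMonoid.induction_on_prime with
  | h₁ => exact absurd rfl hP
  | h₂ Q hQ =>
    obtain ⟨a, ha, rfl⟩ := isUnit_iff.1 hQ
    exact dominatesDerivatives_C h1 ha.ne_zero
  | h₃ Q p hQ hp ih =>
    refine DominatesDerivatives.mul hρ.le ?_ (ih hQ fun z hz => hx z (by rw [map_mul, hz, mul_zero]))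
    obtain ⟨z, hz⟩ := IsAlgClosed.exists_aeval_eq_zero (AlgebraicClosure Ω) p
      (degree_pos_of_irreducible hp.irreducible).ne'
    have hz' := hx z (by rw [map_mul, hz, zero_mul])
    have hmin := minpoly.eq_of_irreducible hp.irreducible hz
    have hlead : p.leadingCoeff ≠ 0 := leadingCoeff_ne_zero.2 hp.ne_zero
    have e : p = minpoly Ω z * C p.leadingCoeff := by
      rw [← hmin, mul_assoc, ← C_mul, inv_mul_cancel₀ hlead, C_1, mul_one]
    rw [e]
    exact (dominatesDerivatives_minpoly h1 hΨ hρ hz'.1 hz'.2).mul hρ.le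
      (dominatesDerivatives_C h1 hlead)

omit [IsAlgClosed k] [IsUltrametricDist Ω] [CompleteSpace Ω] in
-- Factoring P(T(x)) out on the right leaves 1 plus terms of norm at most (‖δ‖/ρ)ʲ with j ≥ 1, to
-- which the geometric series applies.
theorem DominatesDerivatives.isUnit_adjoint (h1 : ‖(1 : A)‖ ≤ 1) {P : Polynomial Ω}
    (hP : DominatesDerivatives Ψ ρ P) {δ : A} (hδ : ‖δ‖ < ρ) (n : ℕ) :
    IsUnit (∑ j ∈ Finset.range (n + 1), (-δ) ^ j * Ψ (tensorEval x Ω (hasseDeriv j P))) := by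
  obtain ⟨w, hw, hw'⟩ := hP
  have hρ : 0 < ρ := (norm_nonneg δ).trans_lt hδ
  have hq : ‖δ‖ / ρ < 1 := (div_lt_one hρ).2 hδ
  have hq0 : 0 ≤ ‖δ‖ / ρ := by positivity
  have e : ∑ j ∈ Finset.range (n + 1), (-δ) ^ j * Ψ (tensorEval x Ω (hasseDeriv j P)) =
      (1 + ∑ j ∈ Finset.range n, (-δ) ^ (j + 1) *
        (Ψ (tensorEval x Ω (hasseDeriv (j + 1) P)) * ↑w⁻¹)) * w := by
    rw [Finset.sum_range_succ', pow_zero, one_mul, hasseDeriv_zero', ← hw, add_mul, one_mul,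
      add_comm, Finset.sum_mul]
    congr 1
    refine Finset.sum_congr rfl fun j _ => ?_
    rw [mul_assoc, mul_assoc, Units.inv_mul, mul_one]
  rw [e]
  refine IsUnit.mul ?_ w.isUnit
  have hs : ‖∑ j ∈ Finset.range n, (-δ) ^ (j + 1) *
      (Ψ (tensorEval x Ω (hasseDeriv (j + 1) P)) * ↑w⁻¹)‖ < 1 := by
    refine lt_of_le_of_lt (IsUltrametricDist.norm_sum_le_of_forall_le_of_nonneg hq0 fun j _ => ?_) hq
    calc _ ≤ ‖δ‖ ^ (j + 1) * ‖Ψ (tensorEval x Ω (hasseDeriv (j + 1) P)) * ↑w⁻¹‖ := by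
          refine (norm_mul_le _ _).trans (mul_le_mul_of_nonneg_right ?_ (norm_nonneg _))
          exact (norm_pow_le' _ (Nat.succ_pos j)).trans_eq (by rw [norm_neg])
      _ = (‖δ‖ / ρ) ^ (j + 1) *
          (‖Ψ (tensorEval x Ω (hasseDeriv (j + 1) P)) * ↑w⁻¹‖ * ρ ^ (j + 1)) := by
          rw [div_pow]
          field_simp
      _ ≤ (‖δ‖ / ρ) ^ (j + 1) * 1 := by
          gcongr
          exact hw' _
      _ ≤ ‖δ‖ / ρ := by
          rw [mul_one]
          exact pow_le_of_le_one hq0 hq.le (Nat.succ_ne_zero _)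
  obtain ⟨v, hv, -⟩ := exists_unit_of_norm_lt_one h1 hs
  exact ⟨v, hv⟩

end Good

/-! ### Points below no root are outside the spectrum. -/

section Subset

variable {k : Type*} [NormedField k] [IsAlgClosed k] {Ω : Type*} [NormedField Ω]
  [NormedAlgebra k Ω] [IsUltrametricDist Ω] [CompleteSpace Ω]
  {E₀ : Type*} [NormedRing E₀] [NormedAlgebra k E₀] {E : Type*} [NormedRing E] [NormedAlgebra k E]

/-- Let `f ∈ E` be the companion matrix of `P(d)`, with entries in the algebra `E₀` of operators
on `Ω`. If `x` is not below a root of `P`, it does not belong to the spectrum of `f`. -/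
theorem notMem_spectrum_of_companion (h1 : ‖(1 : E₀)‖ ≤ 1)
    (g : Ω →ₐ[k] E₀) (hg : ∀ a, ‖g a‖ ≤ ‖a‖) (ι : E₀ →ₐ[k] E) {K : ℝ} (hK : 0 ≤ K)
    (hι : ∀ φ, ‖ι φ‖ ≤ K * ‖φ‖) (δ : E₀) {ρ : ℝ} (hδ : ‖δ‖ < ρ) (f : E) (s r : ℕ → E)
    {P : Polynomial Ω} (hP : P.Monic)
    (hsum : ∑ i ∈ Finset.range P.natDegree, s i * r i = 1)
    (hr0 : 0 < P.natDegree → r 0 * f = ι δ * r 0 - ι (g (P.coeff 0)) * r (P.natDegree - 1))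
    (hr : ∀ j, j + 1 < P.natDegree → r (j + 1) * f =
      r j + ι δ * r (j + 1) - ι (g (P.coeff (j + 1))) * r (P.natDegree - 1))
    (hs : ∀ i, i + 1 < P.natDegree → f * s i = s (i + 1) + s i * ι δ)
    (hsn : 0 < P.natDegree → f * s (P.natDegree - 1) = s (P.natDegree - 1) * ι δ -
      ∑ i ∈ Finset.range P.natDegree, s i * ι (g (P.coeff i)))
    {x : BerkovichLine k} (hx : ∀ z : AlgebraicClosure Ω, aeval z P = 0 →
      x ≠ projPoint k z ∧ ρ ≤ (projPoint k z).radius) : x ∉ spectrum k f := by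
  rw [mem_spectrum_iff, not_not]
  let Ψ : TensorAlg k Ω x.ResidueField →+* CompletedTensor k E₀ x.ResidueField :=
    UniformSpace.Completion.coeRingHom.comp (TensorAlg.mapRingHom g)
  have hΨ (v) : ‖Ψ v‖ ≤ ‖v‖ := by
    change ‖((TensorAlg.mapRingHom g v : TensorAlg k E₀ x.ResidueField) :
      CompletedTensor k E₀ x.ResidueField)‖ ≤ _
    rw [UniformSpace.Completion.norm_coe]
    have := TensorAlg.norm_map_apply_le (H := x.ResidueField) g.toLinearMap zero_le_one
      (fun a => by simpa using hg a) v
    rwa [one_mul] at this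
  have hone : ‖(1 : CompletedTensor k E₀ x.ResidueField)‖ ≤ 1 := by
    rw [← UniformSpace.Completion.coe_one, UniformSpace.Completion.norm_coe]
    exact TensorAlg.norm_one_le h1 norm_one.le
  have hρ : 0 < ρ := (norm_nonneg δ).trans_lt hδ
  let δ' : CompletedTensor k E₀ x.ResidueField :=
    ((TensorAlg.inl x.ResidueField δ : TensorAlg k E₀ x.ResidueField) :)
  have hδ' : ‖δ'‖ < ρ := by
    refine lt_of_le_of_lt ?_ hδ
    rw [UniformSpace.Completion.norm_coe, TensorAlg.inl_apply]
    exact (TensorAlg.norm_tmul_le _ _).trans (by rw [norm_one, mul_one])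
  -- Invertibility is first obtained over operators on Ω, where δ has norm < ρ; it is then
  -- transported by `Λ` to E, so the constant K bounding ι plays no part in the estimate.
  have hunit := (dominatesDerivatives_of_roots hone hΨ hρ P hP.ne_zero hx).isUnit_adjoint hone hδ'
    P.natDegree
  have hcomm : Commute δ' ((Ψ.comp (tensorEval x Ω)) X) := by
    rw [commute_iff_eq, RingHom.comp_apply, tensorEval_X]
    change ((TensorAlg.tmul δ 1 : TensorAlg k E₀ x.ResidueField) :
        CompletedTensor k E₀ x.ResidueField) *
      ((TensorAlg.mapRingHom g (TensorAlg.tmul 1 x.coord) : TensorAlg k E₀ x.ResidueField) :) =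
      ((TensorAlg.mapRingHom g (TensorAlg.tmul 1 x.coord) : TensorAlg k E₀ x.ResidueField) :) *
        ((TensorAlg.tmul δ 1 : TensorAlg k E₀ x.ResidueField) :)
    rw [← UniformSpace.Completion.coe_mul, ← UniformSpace.Completion.coe_mul,
      TensorAlg.mapRingHom_tmul, map_one, TensorAlg.tmul_mul_tmul, TensorAlg.tmul_mul_tmul,
      mul_one, one_mul, one_mul, mul_one]
  have hadj := sum_sub_pow_mul_eq_sum_hasseDeriv (Ψ.comp (tensorEval x Ω)) δ' hcomm P _
    (Nat.lt_succ_self P.natDegree : P.natDegree < P.natDegree + 1)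
  simp only [RingHom.comp_apply] at hadj
  rw [← hadj] at hunit
  let J : E →+* CompletedTensor k E x.ResidueField :=
    UniformSpace.Completion.coeRingHom.comp (TensorAlg.inl x.ResidueField)
  let t : CompletedTensor k E x.ResidueField :=
    ((TensorAlg.tmul 1 x.coord : TensorAlg k E x.ResidueField) :)
  have hJt (e : E) : J e * t = t * J e := by
    change ((TensorAlg.tmul e 1 : TensorAlg k E x.ResidueField) :
      CompletedTensor k E x.ResidueField) * ((TensorAlg.tmul 1 x.coord :
      TensorAlg k E x.ResidueField) :) = ((TensorAlg.tmul 1 x.coord :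
      TensorAlg k E x.ResidueField) :) * ((TensorAlg.tmul e 1 : TensorAlg k E x.ResidueField) :)
    rw [← UniformSpace.Completion.coe_mul, ← UniformSpace.Completion.coe_mul,
      TensorAlg.tmul_mul_tmul, TensorAlg.tmul_mul_tmul, mul_one, one_mul, one_mul, mul_one]
  let Λ : CompletedTensor k E₀ x.ResidueField →+* CompletedTensor k E x.ResidueField :=
    UniformSpace.Completion.mapRingHom (TensorAlg.mapRingHom ι)
      (TensorAlg.continuous_mapRingHom ι hK hι)
  have hΛ (v : TensorAlg k E₀ x.ResidueField) :
      Λ (v : CompletedTensor k E₀ x.ResidueField) =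
        ((TensorAlg.mapRingHom ι v : TensorAlg k E x.ResidueField) :) :=
    UniformSpace.Completion.extensionHom_coe _ _ v
  have hΛδ : Λ δ' = J (ι δ) := by
    refine (hΛ _).trans ?_
    rw [TensorAlg.inl_apply, TensorAlg.mapRingHom_tmul]
    rfl
  have hΛX : Λ (Ψ (tensorEval x Ω X)) = t := by
    refine (hΛ _).trans ?_
    rw [tensorEval_X, TensorAlg.mapRingHom_tmul, TensorAlg.mapRingHom_tmul, map_one, map_one]
  have hΛC (a : Ω) : Λ (Ψ (tensorEval x Ω (C a))) = J (ι (g a)) := by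
    refine (hΛ _).trans ?_
    rw [tensorEval_C, TensorAlg.mapRingHom_tmul, TensorAlg.mapRingHom_tmul]
    rfl
  have hu := hunit.map Λ
  have hlead : P.coeff P.natDegree = 1 := hP
  simp only [map_sum, map_mul, map_pow, map_sub, hΛδ, hΛX, hΛC] at hu
  rw [Finset.sum_range_succ, hlead, map_one, map_one, map_one, mul_one, add_comm] at hu
  have hN : (tensorSubCoord x f : CompletedTensor k E x.ResidueField) = J f - t :=
    UniformSpace.Completion.coe_sub _ _
  rw [hN]
  -- The scalar to subtract is t - δ rather than t, since moving a coefficient past ∇ produces a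
  -- derivative.
  refine isUnit_of_companion P.natDegree (fun i => J (s i)) (fun i => J (r i))
    (fun i => J (ι (g (P.coeff i)))) (t - J (ι δ)) _ ?_ ?_ ?_ ?_ ?_ hu
  · simp only [← map_mul, ← map_sum]
    rw [hsum, map_one]
  · intro h0
    rw [mul_sub, hJt, ← map_mul, hr0 h0, map_sub, map_mul, map_mul, sub_mul]
    abel
  · intro j hj
    rw [mul_sub, hJt, ← map_mul, hr j hj, map_sub, map_add, map_mul, map_mul, sub_mul]
    abel
  · intro i hi
    rw [sub_mul, ← hJt, ← map_mul, hs i hi, map_add, map_mul, mul_sub]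
    abel
  · intro h0
    rw [sub_mul, ← hJt, ← map_mul, hsn h0, map_sub, map_sum, map_mul, mul_sub]
    simp only [map_mul]
    abel

end Subset

/-! ### Matrix units and diagonal operators on M. -/

section RankOne

variable {k : Type*} [NormedField k] {Ω : Type*} [NormedField Ω] [NormedAlgebra k Ω]
  {d : Derivation k Ω Ω} {M : Type*} [NormedAddCommGroup M]
  [NormedSpace Ω M] [NormedSpace k M] [IsScalarTower k Ω M] {D : Connection d M}
  {P : Polynomial Ω}

/-- The operator `m ↦ φ(l(m)) v`. -/
def rankOne (v : M) (l : M →ₗ[Ω] Ω) (φ : Module.End k Ω) : Module.End k M :=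
  (LinearMap.toSpanSingleton Ω M v).restrictScalars k ∘ₗ φ ∘ₗ l.restrictScalars k

theorem rankOne_apply (v : M) (l : M →ₗ[Ω] Ω) (φ : Module.End k Ω) (m : M) :
    rankOne v l φ m = φ (l m) • v := rfl

theorem norm_rankOne_apply_le (v : M) {l : M →ₗ[Ω] Ω} (hl : IsBoundedOp l) (φ : BoundedEnd k Ω)
    (m : M) : ‖rankOne v l φ.1 m‖ ≤ (opNorm l * ‖v‖ * ‖φ‖) * ‖m‖ := by
  rw [rankOne_apply]
  refine (norm_smul_le _ _).trans ?_
  have h1 : ‖φ.1 (l m)‖ ≤ ‖φ‖ * ‖l m‖ := IsBoundedOp.le_opNorm φ.2 (l m)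
  calc _ ≤ (‖φ‖ * (opNorm l * ‖m‖)) * ‖v‖ := by
        gcongr
        exact h1.trans (mul_le_mul_of_nonneg_left (hl.le_opNorm m) (norm_nonneg _))
    _ = _ := by ring

theorem rankOne_mem (v : M) {l : M →ₗ[Ω] Ω} (hl : IsBoundedOp l) {φ : Module.End k Ω}
    (hφ : φ ∈ BoundedEnd k Ω) : rankOne v l φ ∈ BoundedEnd k M :=
  ⟨_, norm_rankOne_apply_le v hl ⟨φ, hφ⟩⟩

variable (k Ω) in
/-- The action of `Ω` on itself by multiplication, by bounded operators. -/
def mulBoundedEnd : Ω →ₐ[k] BoundedEnd k Ω :=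
  (Algebra.lmul k Ω).codRestrict (BoundedEnd k Ω) fun a => ⟨‖a‖, fun m => norm_mul_le a m⟩

theorem mulBoundedEnd_apply (a b : Ω) : (mulBoundedEnd k Ω a).1 b = a * b := rfl

theorem norm_mulBoundedEnd_le (a : Ω) : ‖mulBoundedEnd k Ω a‖ ≤ ‖a‖ :=
  opNorm_le (norm_nonneg a) fun m => norm_mul_le a m

namespace CyclicFrame

variable (F : CyclicFrame D P) (hF : ∀ j, IsBoundedOp (F.coord j))

include F hF in
-- By the Leibniz rule the connection is a finite sum of operators m ↦ d(xᵢ) sᵢ and m ↦ xᵢ ∇(sᵢ),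
-- each bounded because the coordinates xᵢ are.
theorem connection_mem (hd : IsBoundedOp d) : D.toLinearMap ∈ BoundedEnd k M := by
  have h : D.toLinearMap = ∑ i ∈ Finset.range P.natDegree,
      (rankOne (F.s i) (F.coord i) (d : Ω →ₗ[k] Ω) +
        rankOne (D.toLinearMap (F.s i)) (F.coord i) 1) := by
    refine LinearMap.ext fun m => ?_
    conv_lhs => rw [← F.sum_coord m]
    rw [map_sum, LinearMap.sum_apply]
    exact Finset.sum_congr rfl fun i _ => D.leibniz _ _
  rw [h]
  exact sum_mem fun i _ => add_mem (rankOne_mem _ (hF i) hd) (rankOne_mem _ (hF i) (one_mem _))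

/-- The operators acting on coordinates. -/
def diagonal : BoundedEnd k Ω →ₐ[k] BoundedEnd k M where
  toFun φ := ⟨∑ i ∈ Finset.range P.natDegree, rankOne (F.s i) (F.coord i) φ.1,
    sum_mem fun i _ => rankOne_mem _ (hF i) φ.2⟩
  map_one' := Subtype.ext (LinearMap.ext fun m => by
    change (∑ i ∈ Finset.range P.natDegree, rankOne (F.s i) (F.coord i) (1 : Module.End k Ω)) m = m
    rw [LinearMap.sum_apply]
    exact F.sum_coord m)
  map_mul' φ ψ := Subtype.ext (LinearMap.ext fun m => by
    change (∑ i ∈ Finset.range P.natDegree, rankOne (F.s i) (F.coord i) (φ.1 * ψ.1)) m =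
      (∑ i ∈ Finset.range P.natDegree, rankOne (F.s i) (F.coord i) φ.1)
        ((∑ i ∈ Finset.range P.natDegree, rankOne (F.s i) (F.coord i) ψ.1) m)
    simp only [LinearMap.sum_apply, rankOne_apply, Module.End.mul_apply]
    exact Finset.sum_congr rfl fun i hi => by
      rw [F.coord_sum (fun i => ψ.1 (F.coord i m)) (Finset.mem_range.1 hi)])
  map_zero' := Subtype.ext (LinearMap.ext fun m => by
    change (∑ i ∈ Finset.range P.natDegree, rankOne (F.s i) (F.coord i) (0 : Module.End k Ω)) m = 0
    simp [LinearMap.sum_apply, rankOne_apply])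
  map_add' φ ψ := Subtype.ext (LinearMap.ext fun m => by
    change (∑ i ∈ Finset.range P.natDegree, rankOne (F.s i) (F.coord i) (φ.1 + ψ.1)) m =
      (∑ i ∈ Finset.range P.natDegree, rankOne (F.s i) (F.coord i) φ.1) m +
        (∑ i ∈ Finset.range P.natDegree, rankOne (F.s i) (F.coord i) ψ.1) m
    simp only [LinearMap.sum_apply, rankOne_apply, LinearMap.add_apply, add_smul,
      Finset.sum_add_distrib])
  commutes' a := Subtype.ext (LinearMap.ext fun m => by
    change (∑ i ∈ Finset.range P.natDegree, rankOne (F.s i) (F.coord i)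
      (algebraMap k (Module.End k Ω) a)) m = a • m
    rw [LinearMap.sum_apply]
    simp only [rankOne_apply, Module.algebraMap_end_apply, smul_assoc, ← Finset.smul_sum,
      F.sum_coord])

theorem diagonal_apply (φ : BoundedEnd k Ω) (m : M) : (F.diagonal hF φ).1 m =
    ∑ i ∈ Finset.range P.natDegree, φ.1 (F.coord i m) • F.s i := by
  change (∑ i ∈ Finset.range P.natDegree, rankOne (F.s i) (F.coord i) φ.1) m = _
  rw [LinearMap.sum_apply]
  rfl

theorem coord_diagonal (φ : BoundedEnd k Ω) (m : M) {j : ℕ} (hj : j < P.natDegree) :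
    F.coord j ((F.diagonal hF φ).1 m) = φ.1 (F.coord j m) := by
  rw [diagonal_apply, F.coord_sum (fun i => φ.1 (F.coord i m)) hj]

theorem diagonal_smul_s (φ : BoundedEnd k Ω) (a : Ω) {j : ℕ} (hj : j < P.natDegree) :
    (F.diagonal hF φ).1 (a • F.s j) = φ.1 a • F.s j := by
  rw [diagonal_apply, Finset.sum_eq_single j]
  · rw [map_smul, F.coord_s j hj j hj, if_pos rfl, smul_eq_mul, mul_one]
  · intro i hi hij
    rw [map_smul, F.coord_s j hj i (Finset.mem_range.1 hi), if_neg (Ne.symm hij), smul_zero,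
      map_zero, zero_smul]
  · intro h
    exact absurd (Finset.mem_range.2 hj) h

theorem norm_diagonal_le (φ : BoundedEnd k Ω) : ‖F.diagonal hF φ‖ ≤
    (∑ i ∈ Finset.range P.natDegree, opNorm (F.coord i) * ‖F.s i‖) * ‖φ‖ := by
  have h0 : 0 ≤ ∑ i ∈ Finset.range P.natDegree, opNorm (F.coord i) * ‖F.s i‖ :=
    Finset.sum_nonneg fun i _ => mul_nonneg (opNorm_nonneg _) (norm_nonneg _)
  refine opNorm_le (mul_nonneg h0 (norm_nonneg _)) fun m => ?_
  rw [diagonal_apply, Finset.sum_mul, Finset.sum_mul]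
  exact (norm_sum_le _ _).trans (Finset.sum_le_sum fun i _ => norm_rankOne_apply_le _ (hF i) φ m)

/-- The matrix units. -/
def unit (i j : ℕ) : BoundedEnd k M :=
  ⟨rankOne (F.s i) (F.coord j) 1, rankOne_mem _ (hF j) (one_mem _)⟩

theorem unit_apply (i j : ℕ) (m : M) : (F.unit hF i j : BoundedEnd k M).1 m = F.coord j m • F.s i :=
  rfl

include F hF in
-- The columns are the matrix units E_{i0} and the rows are the E_{0j}; operators on Ω act
-- coordinatewise through `diagonal`.
theorem notMem_spectrum [IsAlgClosed k] [IsUltrametricDist Ω] [CompleteSpace Ω]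
    (hD : D.toLinearMap ∈ BoundedEnd k M) (hd : IsBoundedOp d) (hP : P.Monic) {ρ : ℝ}
    (hρ : opNorm d < ρ) {x : BerkovichLine k} (hx : ∀ z : AlgebraicClosure Ω, aeval z P = 0 →
      x ≠ projPoint k z ∧ ρ ≤ (projPoint k z).radius) :
    x ∉ spectrum k (⟨D.toLinearMap, hD⟩ : BoundedEnd k M) := by
  let δ : BoundedEnd k Ω := ⟨(d : Ω →ₗ[k] Ω), hd⟩
  have hδ (a : Ω) : δ.1 a = d a := rfl
  have ext {φ ψ : BoundedEnd k M} (h : ∀ m, φ.1 m = ψ.1 m) : φ = ψ :=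
    Subtype.ext (LinearMap.ext h)
  have mul_apply (φ ψ : BoundedEnd k M) (m : M) : (φ * ψ).1 m = φ.1 (ψ.1 m) := rfl
  have add_apply (φ ψ : BoundedEnd k M) (m : M) : (φ + ψ).1 m = φ.1 m + ψ.1 m := rfl
  have sub_apply (φ ψ : BoundedEnd k M) (m : M) : (φ - ψ).1 m = φ.1 m - ψ.1 m := rfl
  have sum_apply (φ : ℕ → BoundedEnd k M) (m : M) :
      (∑ i ∈ Finset.range P.natDegree, φ i).1 m = ∑ i ∈ Finset.range P.natDegree, (φ i).1 m := by
    induction P.natDegree with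
    | zero => rfl
    | succ n ih => rw [Finset.sum_range_succ, Finset.sum_range_succ, add_apply, ih]
  refine notMem_spectrum_of_companion (opNorm_le zero_le_one fun m => (one_mul ‖m‖).ge)
    (mulBoundedEnd k Ω) norm_mulBoundedEnd_le (F.diagonal hF)
    (Finset.sum_nonneg fun i _ => mul_nonneg (opNorm_nonneg _) (norm_nonneg _))
    (F.norm_diagonal_le hF) δ hρ ⟨D.toLinearMap, hD⟩ (fun i => F.unit hF i 0)
    (fun j => F.unit hF 0 j) hP ?_ ?_ ?_ ?_ ?_ hx
  · refine ext fun m => (sum_apply _ m).trans ((Finset.sum_congr rfl fun i hi => ?_).trans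
      (F.sum_coord m))
    have h0 : 0 < P.natDegree := (Nat.zero_le i).trans_lt (Finset.mem_range.1 hi)
    rw [mul_apply, unit_apply, unit_apply, map_smul, F.coord_s 0 h0 0 h0, if_pos rfl, smul_eq_mul,
      mul_one]
  · intro h0
    obtain ⟨n, hn⟩ : ∃ n, P.natDegree = n + 1 := ⟨P.natDegree - 1, by omega⟩
    refine ext fun m => ?_
    rw [mul_apply, sub_apply, mul_apply, mul_apply, unit_apply, unit_apply, unit_apply,
      F.diagonal_smul_s hF _ _ h0, F.diagonal_smul_s hF _ _ h0, F.coord_apply_zero hn, sub_smul,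
      hδ, mulBoundedEnd_apply, hn, Nat.add_sub_cancel]
  · intro j hj
    have h0 : 0 < P.natDegree := by omega
    obtain ⟨n, hn⟩ : ∃ n, P.natDegree = n + 1 := ⟨P.natDegree - 1, by omega⟩
    refine ext fun m => ?_
    rw [mul_apply, sub_apply, add_apply, mul_apply, mul_apply, unit_apply, unit_apply, unit_apply,
      unit_apply, F.diagonal_smul_s hF _ _ h0, F.diagonal_smul_s hF _ _ h0,
      F.coord_apply_succ hn hj, sub_smul, add_smul, hδ, mulBoundedEnd_apply, hn,
      Nat.add_sub_cancel, add_comm (F.coord j m • F.s 0)]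
  · intro i hi
    have h0 : 0 < P.natDegree := by omega
    refine ext fun m => ?_
    rw [mul_apply, add_apply, mul_apply, unit_apply, unit_apply, unit_apply,
      F.coord_diagonal hF _ _ h0, D.leibniz, F.apply_s i hi, hδ, add_comm]
  · intro h0
    refine ext fun m => ?_
    rw [mul_apply, sub_apply, sum_apply, mul_apply, unit_apply, unit_apply,
      F.coord_diagonal hF _ _ h0, D.leibniz, F.apply_s_last h0, hδ, smul_neg, ← sub_eq_add_neg,
      Finset.smul_sum]
    congr 1
    refine Finset.sum_congr rfl fun i _ => ?_
    rw [mul_apply, unit_apply, F.coord_diagonal hF _ _ h0, mulBoundedEnd_apply, mul_comm, mul_smul]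

end CyclicFrame

end RankOne

end BerkovichSpectrum

end

/-! ### The two inclusions. -/

theorem mainTheorem2
    {k : Type*} [NormedField k] [IsUltrametricDist k] [CompleteSpace k] [CharZero k]
    [IsAlgClosed k]
    {Ω : Type*} [NormedField Ω] [IsUltrametricDist Ω] [CompleteSpace Ω] [NormedAlgebra k Ω]
    (d : Derivation k Ω Ω) (hd : BerkovichSpectrum.IsBoundedOp d)
    {M : Type*} [NormedAddCommGroup M] [IsUltrametricDist M] [CompleteSpace M]
    [NormedSpace Ω M] [FiniteDimensional Ω M] [NormedSpace k M] [IsScalarTower k Ω M]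
    (D : BerkovichSpectrum.Connection d M)
    (P : Polynomial Ω) (hP : P.Monic)
    (hDP : D.IsIsomorphic (BerkovichSpectrum.cyclicConnection d P))
    (hroots : ∀ z ∈ P.aroots (AlgebraicClosure Ω),
      BerkovichSpectrum.opNorm d < (BerkovichSpectrum.projPoint k z).radius) :
    ∃ hD : D.toLinearMap ∈ BerkovichSpectrum.BoundedEnd k M,
      BerkovichSpectrum.spectrum k (⟨D.toLinearMap, hD⟩ : BerkovichSpectrum.BoundedEnd k M) =
        BerkovichSpectrum.projPoint k '' {z | z ∈ P.aroots (AlgebraicClosure Ω)} := by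
  classical
  obtain ⟨F⟩ := BerkovichSpectrum.exists_cyclicFrame hP hDP
  have hF (j : ℕ) : BerkovichSpectrum.IsBoundedOp (F.coord j) :=
    BerkovichSpectrum.isBoundedOp_linearForm _
  have hD := F.connection_mem hF hd
  have hmem (z : AlgebraicClosure Ω) :
      z ∈ P.aroots (AlgebraicClosure Ω) ↔ Polynomial.aeval z P = 0 := by
    rw [Polynomial.mem_aroots]
    exact and_iff_right hP.ne_zero
  refine ⟨hD, Set.Subset.antisymm (fun x hx => ?_) ?_⟩
  · by_contra hne
    -- As there are finitely many roots, some ρ lies strictly between ‖d‖ and all their radii; the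
    -- strict inequality ‖d‖ < ρ makes the geometric series converge.
    have hgt : ∀ᶠ ρ in nhdsWithin (BerkovichSpectrum.opNorm d) (Set.Ioi (BerkovichSpectrum.opNorm d)),
        BerkovichSpectrum.opNorm d < ρ := self_mem_nhdsWithin
    obtain ⟨ρ, hρ, hρ'⟩ : ∃ ρ, (∀ z ∈ (P.aroots (AlgebraicClosure Ω)).toFinset,
        ρ < (BerkovichSpectrum.projPoint k z).radius) ∧ BerkovichSpectrum.opNorm d < ρ :=
      (((Filter.eventually_all_finset _).2 fun z hz =>
        (eventually_lt_nhds (hroots z (Multiset.mem_toFinset.1 hz))).filter_mono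
          nhdsWithin_le_nhds).and hgt).exists
    exact F.notMem_spectrum hF hD hd hP hρ' (fun z hz => ⟨fun h => hne ⟨z, (hmem z).2 hz, h.symm⟩,
      (hρ z (Multiset.mem_toFinset.2 ((hmem z).2 hz))).le⟩) hx
  · rintro _ ⟨z, hz, rfl⟩
    exact F.projPoint_mem_spectrum hD hd hF hP ((hmem z).1 hz) (hroots z hz)
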